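/- **Setting.** All manifolds, maps, functions, forms, vector fields and sections are smooth ($C^\infty$), manifolds are finite-dimensional and without boundary; $\pi:T^*Q\to Q$ is the projection. *The nonholonomic system.* Let $Q$ be a manifold with a Riemannian metric $\langle\cdot,\cdot\rangle$, $L(v_q)=\tfrac12\langle v_q,v_q\rangle-V(q)$ a Lagrangian on $TQ$, and $\mathbb{F}L:TQ\to T^*Q$, $\langle\mathbb{F}L(v),w\rangle=\frac{d}{dt}\big|_{t=0}L(v+tw)$, its Legendre transformation. Let $\phi^1,\dots,\phi^k$ be one-forms on $Q$, linearly independent at every point, $\mathcal D=\bigcap_j\ker\phi^j\subseteq TQ$, and $M=\mathbb{F}L(\mathcal D)\subseteq T^*Q$, with its structure of embedded submanifold; $i:M\hookrightarrow T^*Q$ is the inclusion. Let $\omega=-\mathbf d\theta$ be the canonical symplectic form on $T^*Q$ ($\theta(p)(u)=\langle p,T\pi u\rangle$), $\omega_M=i^*\omega$, and $\mathcal H=TM\cap(T\pi)^{-1}(\mathcal D)$. The Dirac structure $D\subseteq TM\oplus T^*M$ has the fibres $$D(m)=\{(u,\alpha)\in T_mM\oplus T_m^*M\mid u\in\mathcal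 H(m),\ (\alpha-\omega_M(u,\cdot))|_{\mathcal H(m)}=0\}.$$ *The symmetry.* Let a Lie group $G$ with Lie algebra $\mathfrak g$ act on $Q$, leaving $\mathcal D$ and $L$ invariant. The cotangent lift $\Phi_g=(T\phi_{g^{-1}})^*$ of the action $\phi$ restricts to $M$; $\xi_Q$, $\xi_M$ are the infinitesimal generators of $\xi\in\mathfrak g$. Put $\mathcal V(m)=\{\xi_M(m)\mid\xi\in\mathfrak g\}$, let $\mathfrak g^{\mathcal H}\subseteq M\times\mathfrak g$ have the fibres $\mathfrak g^m=\{\xi\in\mathfrak g\mid\xi_M(m)\in(\mathcal V\cap\mathcal H)(m)\}$, and let $\langle\mathbf J(p),\xi\rangle=\langle p,\xi_Q(\pi(p))\rangle$. For a $\mathfrak g$-valued function $\xi$ on an open subset of $M$, put $\mathbf J^{\xi}(m)=\langle\mathbf J(m),\xi(m)\rangle$, and, for a vector field $X$, let $X[\xi]$ be the derivative of $\xi$ along $X$ (so $X[\xi]=\sum_iX[f_i]\,\xi^i$ if $\xi=\sum_if_i\xi^i$ with a basis $\xi^i$ of $\mathfrak g$). **Theorem 6.1 (Nonholonomic Noether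 momentum equation).** Assume that $\mathcal H+\mathcal V$ has constant rank on $M$. (1) Let $\xi^{\mathcal H}$ be a section of $\mathfrak g^{\mathcal H}$ on an open set $U\subseteq M$, let $h$ be a $G$-invariant function on $M$, and let $X_h$ be a vector field on $U$ solving the implicit Hamiltonian system $(X_h,\mathbf dh)\in\Gamma(D)$. Then $\mathbf J^{\xi^{\mathcal H}}$ is smooth on $U$ and $$\mathbf d\mathbf J^{\xi^{\mathcal H}}(X_h)-\mathbf J^{X_h[\xi^{\mathcal H}]}=0\quad\text{on }U.$$ (2) This is the Hamiltonian form of the Lagrangian nonholonomic momentum equation, in the following sense. Let $\xi^{\mathcal D}:W\to\mathfrak g$, $W\subseteq Q$ open, be a smooth map with $(\xi^{\mathcal D}(q))_Q(q)\in\mathcal D(q)$ for all $q\in W$. Then $\xi^{\mathcal H}:=\xi^{\mathcal D}\circ\pi|_M$ is a section of $\mathfrak g^{\mathcal H}$ on $M\cap\pi^{-1}(W)$. Let $p(t)\in M$ be an integral curve, for $t$ near $t_0$, of a vector field $X$ on $M$, let $c(t)=(\mathbb{F}L)^{-1}(p(t))$, $q(t)=\pi(p(t))$, and assume $q(t_0)\in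 W$. Write $J^{\rm nhc}(\xi)(v_q)=\langle\mathbb{F}L(v_q),\xi_Q(q)\rangle$. Then, at $t=t_0$, the functions $\xi^{\mathcal D}(q(t))$ and $J^{\rm nhc}(\xi^{\mathcal D}(q(t)))(c(t))$ are differentiable and $$\Big(\mathbf d\mathbf J^{\xi^{\mathcal H}}(X)-\mathbf J^{X[\xi^{\mathcal H}]}\Big)(p(t))=\frac{d}{dt}J^{\rm nhc}\big(\xi^{\mathcal D}(q(t))\big)(c(t))-\Big\langle\mathbb{F}L(c(t)),\Big(\frac{d}{dt}\xi^{\mathcal D}(q(t))\Big)_Q(q(t))\Big\rangle .$$ If moreover $X$ is, near $p(t_0)$, a smooth solution of $(X,\mathbf dH)\in\Gamma(D)$ for the Hamiltonian $H(\mathbb{F}L(v))=\langle\mathbb{F}L(v),v\rangle-L(v)$ restricted to $M$, then at $t=t_0$ one has $c(t)=(q(t),\dot q(t))$ and the Lagrangian momentum equation $$\frac{d}{dt}J^{\rm nhc}\big(\xi^{\mathcal D}(q(t))\big)(c(t))=\Big\langle\mathbb{F}L(c(t)),\Big(\frac{d}{dt}\xi^{\mathcal D}(q(t))\Big)_Q(q(t))\Big\rangle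 .$$ -/

import Mathlib

open scoped Manifold ContDiff Topology
open Manifold

noncomputable section

namespace Nonholonomic

/-! ### Generalities on manifolds and group actions -/

section Generalities

variable {E : Type*} [NormedAddCommGroup E] [NormedSpace ℝ E]
  {H : Type*} [TopologicalSpace H] (I : ModelWithCorners ℝ E H)
  {N : Type*} [TopologicalSpace N] [ChartedSpace H N]

/-- The derivative `T_x φ : T_x N → E` at `x` of the preferred chart `φ` around `x`. -/
def chartDeriv (x : N) : TangentSpace I x →L[ℝ] E :=
  mfderiv I 𝓘(ℝ, E) (extChartAt I x) x

/-- The expression `(φ⁻¹)^* θ` of a `1`-form `θ` in the preferred chart `φ` around `x`. -/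
def chartPullback (θ : ∀ x : N, TangentSpace I x →L[ℝ] ℝ) (x : N) (y : E) : E →L[ℝ] ℝ :=
  (θ ((extChartAt I x).symm y)).comp (mfderiv 𝓘(ℝ, E) I (extChartAt I x).symm y)

/-- The exterior derivative of a `1`-form `θ` on a manifold without boundary, computed in the
preferred chart `φ` around `x`: with `θ' = (φ⁻¹)^* θ`, a map from the model space to its dual,
`dθ(u, v) = (Dθ'(φ x) (Tφ u)) (Tφ v) - (Dθ'(φ x) (Tφ v)) (Tφ u)`.
(The convention is `dθ(X, Y) = X[θ(Y)] - Y[θ(X)] - θ([X, Y])`.) -/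
def extDerivOneForm (θ : ∀ x : N, TangentSpace I x →L[ℝ] ℝ) (x : N)
    (u v : TangentSpace I x) : ℝ :=
  fderiv ℝ (chartPullback I θ x) (extChartAt I x x) (chartDeriv I x u) (chartDeriv I x v) -
    fderiv ℝ (chartPullback I θ x) (extChartAt I x x) (chartDeriv I x v) (chartDeriv I x u)

variable {EG : Type*} [NormedAddCommGroup EG] [NormedSpace ℝ EG]
  {G : Type*} [TopologicalSpace G] [ChartedSpace EG G] [Group G]

/-- For a map `a : G → N → N` with `a 1 x = x`, the derivative `ξ ↦ ξ_N(x) = T_1 (g ↦ a g x) ξ` of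
the orbit map; `ξ_N` is the infinitesimal generator of the action `a` given by `ξ`. -/
def infinitesimalGenerator (a : G → N → N) (x : N) :
    GroupLieAlgebra 𝓘(ℝ, EG) G →L[ℝ] TangentSpace I x :=
  (mfderiv 𝓘(ℝ, EG) I (fun g : G => a g x) 1 : EG →L[ℝ] E)

end Generalities

/-! ### The tangent action -/

section TangentAction

variable {E : Type*} [NormedAddCommGroup E] [NormedSpace ℝ E]
  {Q : Type*} [TopologicalSpace Q] [ChartedSpace E Q]
  {G : Type*} [Group G] [MulAction G Q]

/-- The tangent map `T_q φ_g : T_q Q → T_{g • q} Q` of `φ_g : q ↦ g • q`. -/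
def tangentAction (g : G) (q : Q) :
    TangentSpace 𝓘(ℝ, E) q →L[ℝ] TangentSpace 𝓘(ℝ, E) (g • q) :=
  mfderiv 𝓘(ℝ, E) 𝓘(ℝ, E) (fun x : Q => g • x) q

variable {EG : Type*} [NormedAddCommGroup EG] [NormedSpace ℝ EG]
  [TopologicalSpace G] [ChartedSpace EG G]

/-- `T φ_g ∘ T φ_{g⁻¹} = id`. -/
theorem tangentAction_tangentAction_inv [ContMDiffSMul 𝓘(ℝ, EG) 𝓘(ℝ, E) ∞ G Q]
    (g : G) (q : Q) (w : E) :
    (tangentAction g q : E →L[ℝ] E) ((tangentAction g⁻¹ (g • q) : E →L[ℝ] E) w) = w := by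
  have hs : ∀ a : G, MDifferentiable 𝓘(ℝ, E) 𝓘(ℝ, E) (fun x : Q => a • x) := by
    intro a
    have : ContMDiff 𝓘(ℝ, E) 𝓘(ℝ, E) ∞ (fun x : Q => a • x) :=
      (contMDiff_smul (I := 𝓘(ℝ, EG)) (I' := 𝓘(ℝ, E)) (n := ∞) (G := G) (M := Q)).comp
        (contMDiff_const.prodMk contMDiff_id)
    exact this.mdifferentiable (by simp)
  have hq : g⁻¹ • (g • q) = q := inv_smul_smul g q
  have h1 : HasMFDerivAt 𝓘(ℝ, E) 𝓘(ℝ, E) (fun x : Q => g • x) (g⁻¹ • (g • q))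
      (tangentAction g (g⁻¹ • (g • q))) := (hs g _).hasMFDerivAt
  have h2 : HasMFDerivAt 𝓘(ℝ, E) 𝓘(ℝ, E) (fun x : Q => g⁻¹ • x) (g • q)
      (tangentAction g⁻¹ (g • q)) := (hs g⁻¹ _).hasMFDerivAt
  have h3 := h1.comp (g • q) h2
  have h4 : (fun x : Q => g • x) ∘ (fun x : Q => g⁻¹ • x) = id := by
    funext x; simp
  rw [h4] at h3
  have h5 := hasMFDerivAt_unique h3 (hasMFDerivAt_id (g • q))
  have h6 : ∀ q' : Q, q' = q → (tangentAction g q' : E →L[ℝ] E) = tangentAction g q := by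
    rintro _ rfl; rfl
  have h7 := congrArg (fun l : E →L[ℝ] E => l w) h5
  rw [← h6 _ hq]
  exact h7

end TangentAction

/-! ### The cotangent bundle -/

section Cotangent

/-- The cotangent bundle `T^*Q`. -/
abbrev CotangentBundle (E : Type*) [NormedAddCommGroup E] [NormedSpace ℝ E]
    (Q : Type*) [TopologicalSpace Q] [ChartedSpace E Q] : Type _ :=
  Bundle.TotalSpace (E →L[ℝ] ℝ) (fun q : Q => TangentSpace 𝓘(ℝ, E) q →L[ℝ] ℝ)

/-- The model of the cotangent bundle of a manifold modelled on `E`. -/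
abbrev cotangentModel (E : Type*) [NormedAddCommGroup E] [NormedSpace ℝ E] :
    ModelWithCorners ℝ (E × (E →L[ℝ] ℝ)) (ModelProd E (E →L[ℝ] ℝ)) :=
  𝓘(ℝ, E).prod 𝓘(ℝ, E →L[ℝ] ℝ)

variable {E : Type*} [NormedAddCommGroup E] [NormedSpace ℝ E]
  {Q : Type*} [TopologicalSpace Q] [ChartedSpace E Q] [IsManifold 𝓘(ℝ, E) ∞ Q]

/-- The derivative `Tπ` of the cotangent bundle projection `π : T^*Q → Q`. -/
def cotangentProjDeriv (p : CotangentBundle E Q) :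
    TangentSpace (cotangentModel E) p →L[ℝ] TangentSpace 𝓘(ℝ, E) p.proj :=
  mfderiv (cotangentModel E) 𝓘(ℝ, E) (fun p : CotangentBundle E Q => p.proj) p

/-- The canonical (Liouville) one-form `θ(p)(u) = ⟨p, Tπ u⟩` on `T^*Q`. -/
def canonicalOneForm (p : CotangentBundle E Q) :
    TangentSpace (cotangentModel E) p →L[ℝ] ℝ :=
  p.snd.comp (cotangentProjDeriv p)

/-- The canonical symplectic form `ω = -dθ` (in coordinates `dqⁱ ∧ dpᵢ`) on `T^*Q`. -/
def canonicalForm (p : CotangentBundle E Q) (u v : TangentSpace (cotangentModel E) p) : ℝ :=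
  -extDerivOneForm (cotangentModel E) canonicalOneForm p u v

/-- The fibre derivative (Legendre transformation) `𝔽L : TQ → T^*Q`,
`⟨𝔽L(v), w⟩ = d/dt|_{t=0} L(v + t w)`. -/
def fiberDerivative (L : TangentBundle 𝓘(ℝ, E) Q → ℝ) (v : TangentBundle 𝓘(ℝ, E) Q) :
    CotangentBundle E Q :=
  ⟨v.proj, (fderiv ℝ (fun w : E => L ⟨v.proj, w⟩) v.snd : E →L[ℝ] ℝ)⟩

variable {G : Type*} [Group G] [MulAction G Q]

/-- The cotangent lift `Φ_g = (T φ_{g⁻¹})^* : T^*_q Q → T^*_{g • q} Q`. -/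
def cotangentLift (g : G) (p : CotangentBundle E Q) : CotangentBundle E Q :=
  ⟨g • p.proj, (p.snd : E →L[ℝ] ℝ).comp (tangentAction g⁻¹ (g • p.proj) : E →L[ℝ] E)⟩

variable {EG : Type*} [NormedAddCommGroup EG] [NormedSpace ℝ EG]
  [TopologicalSpace G] [ChartedSpace EG G]

/-- The infinitesimal generator on the configuration space, as the linear map `ξ ↦ ξ_Q(q)`. -/
def generatorQ (q : Q) : GroupLieAlgebra 𝓘(ℝ, EG) G →L[ℝ] TangentSpace 𝓘(ℝ, E) q :=
  infinitesimalGenerator 𝓘(ℝ, E) (fun (g : G) (x : Q) => g • x) q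

/-- The canonical momentum map `J^ξ(p) = ⟨J(p), ξ⟩ = ⟨p, ξ_Q(π(p))⟩`. -/
def momentumMap (p : CotangentBundle E Q) (ξ : GroupLieAlgebra 𝓘(ℝ, EG) G) : ℝ :=
  p.snd (generatorQ p.proj ξ)

end Cotangent

/-! ### Nonholonomic systems -/

/-- A nonholonomic mechanical system on `Q`: a Riemannian metric (giving the kinetic energy), a
potential, and constraint forms `φ¹, …, φᵏ` that are linearly independent at every point. -/
structure System (E : Type*) [NormedAddCommGroup E] [NormedSpace ℝ E]
    (Q : Type*) [TopologicalSpace Q] [ChartedSpace E Q] [IsManifold 𝓘(ℝ, E) ∞ Q] (k : ℕ) where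
  /-- The Riemannian metric. -/
  metric : Bundle.ContMDiffRiemannianMetric 𝓘(ℝ, E) ∞ E
    (fun q : Q => TangentSpace 𝓘(ℝ, E) q)
  /-- The potential energy. -/
  potential : Q → ℝ
  contMDiff_potential : ContMDiff 𝓘(ℝ, E) 𝓘(ℝ, ℝ) ∞ potential
  /-- The constraint one-forms. -/
  form : Fin k → ∀ q : Q, TangentSpace 𝓘(ℝ, E) q →L[ℝ] ℝ
  contMDiff_form : ∀ j, ContMDiff 𝓘(ℝ, E) (cotangentModel E) ∞
    (fun q => (⟨q, form j q⟩ : CotangentBundle E Q))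
  linearIndependent_form : ∀ q, LinearIndependent ℝ (fun j => form j q)

namespace System

variable {E : Type*} [NormedAddCommGroup E] [NormedSpace ℝ E]
  {Q : Type*} [TopologicalSpace Q] [ChartedSpace E Q] [IsManifold 𝓘(ℝ, E) ∞ Q] {k : ℕ}
  (S : System E Q k)

/-- The Lagrangian `L(v_q) = ½ ⟨v_q, v_q⟩ - V(q)`. -/
def lagrangian (v : TangentBundle 𝓘(ℝ, E) Q) : ℝ :=
  1 / 2 * S.metric.inner v.proj v.snd v.snd - S.potential v.proj

/-- The constraint distribution `𝒟 ⊆ TQ`, the common kernel of the constraint forms. -/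
def constraint (q : Q) : Submodule ℝ (TangentSpace 𝓘(ℝ, E) q) :=
  ⨅ j, LinearMap.ker (S.form j q).toLinearMap

/-- The Legendre transformation `𝔽L : TQ → T^*Q` of the system. -/
def legendre (v : TangentBundle 𝓘(ℝ, E) Q) : CotangentBundle E Q :=
  fiberDerivative S.lagrangian v

/-- The constraint manifold `M = 𝔽L(𝒟) ⊆ T^*Q`. -/
def constraintManifold : Set (CotangentBundle E Q) :=
  S.legendre '' {v | v.snd ∈ S.constraint v.proj}

/-- The Hamiltonian `H(p) = ⟨p, v⟩ - L(v)`, `v = (𝔽L)⁻¹(p)`, on `T^*Q`. (The map `𝔽L` is bijective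
on each fibre.) -/
def hamiltonian (p : CotangentBundle E Q) : ℝ :=
  let v : TangentSpace 𝓘(ℝ, E) p.proj :=
    Function.invFun (fun w => (S.legendre ⟨p.proj, w⟩).snd) p.snd
  p.snd v - S.lagrangian ⟨p.proj, v⟩

/-- The fibre derivative of the Lagrangian is the metric. -/
theorem hasFDerivAt_lagrangian (q : Q) (v : E) :
    HasFDerivAt (fun w : E => S.lagrangian ⟨q, w⟩) (S.metric.inner q v : E →L[ℝ] ℝ) v := by
  have key : ∀ (B : E →L[ℝ] E →L[ℝ] ℝ) (c : ℝ), (∀ x y, B x y = B y x) →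
      HasFDerivAt (fun w : E => 1 / 2 * B w w - c) (B v) v := by
    intro B c hB
    have h := (B.hasFDerivAt (x := v)).clm_apply (hasFDerivAt_id (𝕜 := ℝ) v)
    refine ((h.const_mul (1 / 2 : ℝ)).sub_const c).congr_fderiv ?_
    ext w
    have := hB w v
    simp [this]
    ring
  exact key (S.metric.inner q) (S.potential q) (S.metric.symm q)

/-- `⟨𝔽L(v), w⟩` is the inner product of `v` and `w`. -/
theorem legendre_mk (q : Q) (v : TangentSpace 𝓘(ℝ, E) q) :
    S.legendre ⟨q, v⟩ = ⟨q, S.metric.inner q v⟩ := by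
  unfold legendre fiberDerivative
  have h := HasFDerivAt.fderiv (𝕜 := ℝ) (E := E) (F := ℝ) (S.hasFDerivAt_lagrangian q v)
  exact congrArg (fun l : E →L[ℝ] ℝ => (⟨q, l⟩ : CotangentBundle E Q)) h

variable {EG : Type*} [NormedAddCommGroup EG] [NormedSpace ℝ EG]
  (G : Type*) [TopologicalSpace G] [ChartedSpace EG G] [Group G] [MulAction G Q]

/-- The action of `G` on `Q` leaves the constraint distribution and the Lagrangian invariant. -/
structure IsSymmetry : Prop where
  constraint_invariant : ∀ (g : G) (q : Q) (v : TangentSpace 𝓘(ℝ, E) q),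
    v ∈ S.constraint q → tangentAction g q v ∈ S.constraint (g • q)
  lagrangian_invariant : ∀ (g : G) (q : Q) (v : TangentSpace 𝓘(ℝ, E) q),
    S.lagrangian ⟨g • q, tangentAction g q v⟩ = S.lagrangian ⟨q, v⟩

variable {G}

/-- The cotangent lift of a symmetry leaves the constraint manifold invariant. -/
theorem IsSymmetry.cotangentLift_mem {S : System E Q k}
    [ContMDiffSMul 𝓘(ℝ, EG) 𝓘(ℝ, E) ∞ G Q] (hS : S.IsSymmetry G) (g : G)
    {p : CotangentBundle E Q} (hp : p ∈ S.constraintManifold) :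
    cotangentLift g p ∈ S.constraintManifold := by
  obtain ⟨⟨q, v⟩, hv, rfl⟩ := hp
  refine ⟨⟨g • q, tangentAction g q v⟩, hS.constraint_invariant g q v hv, ?_⟩
  rw [S.legendre_mk, S.legendre_mk]
  let A : E →L[ℝ] E := tangentAction g q
  have key : ∀ (f f' : E → ℝ) (l l' : E →L[ℝ] ℝ) (x : E), HasFDerivAt f l (A x) →
      HasFDerivAt f' l' x → (∀ w, f (A w) = f' w) → l.comp A = l' := by
    intro f f' l l' x hf hf' h
    have h1 := hf.comp x A.hasFDerivAt
    have h2 : f ∘ A = f' := funext h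
    rw [h2] at h1
    exact h1.unique hf'
  have h3 := key _ _ _ _ v (S.hasFDerivAt_lagrangian (g • q) (A v))
    (S.hasFDerivAt_lagrangian q v) (fun w => hS.lagrangian_invariant g q w)
  refine congrArg (fun l : E →L[ℝ] ℝ => (⟨g • q, l⟩ : CotangentBundle E Q)) ?_
  refine ContinuousLinearMap.ext fun w : E => ?_
  have h4 := congrArg (fun l : E →L[ℝ] ℝ => l ((tangentAction g⁻¹ (g • q) : E →L[ℝ] E) w)) h3
  refine Eq.trans ?_ h4
  have h5 := tangentAction_tangentAction_inv (EG := EG) g q w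
  exact congrArg (S.metric.inner (g • q) (A v) : E →L[ℝ] ℝ) h5.symm

/-- The action `Φ` of `G` on the constraint manifold `M`. -/
def actionM {S : System E Q k} [ContMDiffSMul 𝓘(ℝ, EG) 𝓘(ℝ, E) ∞ G Q] (hS : S.IsSymmetry G)
    (g : G) (m : S.constraintManifold) : S.constraintManifold :=
  ⟨cotangentLift g m, hS.cotangentLift_mem (EG := EG) g m.2⟩

/-! ### Geometry of the constraint manifold

`M` carries its structure of embedded submanifold of `T^*Q`, with model space `EM`. -/

variable (EM : Type*) [NormedAddCommGroup EM] [NormedSpace ℝ EM]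

section Geometry

variable [ChartedSpace EM S.constraintManifold]

/-- The derivative `Ti : T_m M → T_m (T^*Q)` of the inclusion `i : M → T^*Q`. -/
def inclusionDeriv (m : S.constraintManifold) :
    TangentSpace 𝓘(ℝ, EM) m →L[ℝ] TangentSpace (cotangentModel E) (m : CotangentBundle E Q) :=
  mfderiv 𝓘(ℝ, EM) (cotangentModel E)
    (Subtype.val : S.constraintManifold → CotangentBundle E Q) m

/-- The two-form `ω_M = i^* ω` on `M`. -/
def formM (m : S.constraintManifold) (u v : TangentSpace 𝓘(ℝ, EM) m) : ℝ :=
  canonicalForm (m : CotangentBundle E Q) (S.inclusionDeriv EM m u) (S.inclusionDeriv EM m v)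

/-- The nonholonomic horizontal distribution `ℋ = TM ∩ (Tπ)⁻¹(𝒟)`. -/
def horizontal (m : S.constraintManifold) : Submodule ℝ (TangentSpace 𝓘(ℝ, EM) m) :=
  (S.constraint (m : CotangentBundle E Q).proj).comap
    ((cotangentProjDeriv (m : CotangentBundle E Q)).comp (S.inclusionDeriv EM m)).toLinearMap

/-- The fibre at `m` of the Dirac structure of the system: the pairs `(u, α) ∈ T_m M ⊕ T_m^* M`
with `u ∈ ℋ(m)` and `α - ω_M(u, ·)` in the annihilator of `ℋ(m)`. -/
def diracStructure (m : S.constraintManifold) :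
    Set (TangentSpace 𝓘(ℝ, EM) m × (TangentSpace 𝓘(ℝ, EM) m →L[ℝ] ℝ)) :=
  {x | x.1 ∈ S.horizontal EM m ∧ ∀ w ∈ S.horizontal EM m, x.2 w - S.formM EM m x.1 w = 0}

/-- The vector field `X`, smooth on the open set `U ⊆ M`, solves on `U` the implicit Hamiltonian
system `(X, dh) ∈ Γ(D)`. -/
structure IsSolutionOn [IsManifold 𝓘(ℝ, EM) ∞ S.constraintManifold]
    (h : S.constraintManifold → ℝ)
    (X : ∀ m : S.constraintManifold, TangentSpace 𝓘(ℝ, EM) m)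
    (U : Set S.constraintManifold) : Prop where
  contMDiffOn : ContMDiffOn 𝓘(ℝ, EM) 𝓘(ℝ, EM).tangent ∞
    (fun m => (⟨m, X m⟩ : TangentBundle 𝓘(ℝ, EM) S.constraintManifold)) U
  mem_dirac : ∀ m ∈ U, (X m, mvfderiv 𝓘(ℝ, EM) h m) ∈ S.diracStructure EM m

end Geometry

section Symmetry

variable {S} [ChartedSpace EM S.constraintManifold]
  [ContMDiffSMul 𝓘(ℝ, EG) 𝓘(ℝ, E) ∞ G Q] (hS : S.IsSymmetry G)

/-- The linear map `ξ ↦ ξ_M(m)`, where `ξ_M` is the infinitesimal generator on `M`. -/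
def generatorM (m : S.constraintManifold) :
    GroupLieAlgebra 𝓘(ℝ, EG) G →L[ℝ] TangentSpace 𝓘(ℝ, EM) m :=
  infinitesimalGenerator 𝓘(ℝ, EM) (actionM (EG := EG) hS) m

/-- The vertical distribution `𝒱(m) = {ξ_M(m) | ξ ∈ 𝔤}`. -/
def vertical (m : S.constraintManifold) : Submodule ℝ (TangentSpace 𝓘(ℝ, EM) m) :=
  LinearMap.range (generatorM (EG := EG) EM hS m).toLinearMap

/-- The fibre `𝔤^m = {ξ ∈ 𝔤 | ξ_M(m) ∈ (𝒱 ∩ ℋ)(m)}` of `𝔤^ℋ`. -/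
def horizontalAlgebra (m : S.constraintManifold) :
    Submodule ℝ (GroupLieAlgebra 𝓘(ℝ, EG) G) :=
  (vertical (EG := EG) EM hS m ⊓ S.horizontal EM m).comap
    (generatorM (EG := EG) EM hS m).toLinearMap

/-- `ξ` is a smooth section of `𝔤^ℋ` on the open set `U ⊆ M`. As the bundle `𝔤^ℋ` sits in the
trivial bundle `M × 𝔤`, a section is a `𝔤`-valued map; `𝔤 = T_1 G` is the normed space `EG`. -/
structure IsSectionOn (ξ : S.constraintManifold → GroupLieAlgebra 𝓘(ℝ, EG) G)
    (U : Set S.constraintManifold) : Prop where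
  contMDiffOn : ContMDiffOn (M' := EG) 𝓘(ℝ, EM) 𝓘(ℝ, EG) ∞ ξ U
  mem_algebra : ∀ m ∈ U, ξ m ∈ horizontalAlgebra (EG := EG) EM hS m

end Symmetry

section Momentum

variable {S} [ChartedSpace EM S.constraintManifold]

/-- The function `J^ξ : m ↦ ⟨J(m), ξ(m)⟩` on `M`, for a `𝔤`-valued map `ξ` on `M`. -/
def momentumAlong (ξ : S.constraintManifold → GroupLieAlgebra 𝓘(ℝ, EG) G)
    (m : S.constraintManifold) : ℝ :=
  momentumMap (EG := EG) (G := G) (m : CotangentBundle E Q) (ξ m)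

/-- The derivative `X[ξ] = ∑ X[fᵢ] ξᵢ` of a `𝔤`-valued map `ξ = ∑ fᵢ ξᵢ` along a vector field. -/
def derivAlong (X : ∀ m : S.constraintManifold, TangentSpace 𝓘(ℝ, EM) m)
    (ξ : S.constraintManifold → GroupLieAlgebra 𝓘(ℝ, EG) G)
    (m : S.constraintManifold) : GroupLieAlgebra 𝓘(ℝ, EG) G :=
  mvfderiv (F := EG) 𝓘(ℝ, EM) ξ m (X m)

/-- The left-hand side `dJ^ξ(X) - J^{X[ξ]}` of the nonholonomic momentum equation, at `m`. -/
def momentumDefect (X : ∀ m : S.constraintManifold, TangentSpace 𝓘(ℝ, EM) m)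
    (ξ : S.constraintManifold → GroupLieAlgebra 𝓘(ℝ, EG) G) (m : S.constraintManifold) : ℝ :=
  mvfderiv 𝓘(ℝ, EM) (momentumAlong ξ) m (X m) - momentumAlong (derivAlong EM X ξ) m

end Momentum

section Lagrangian

/-- The fibre `𝔤^𝒟(q) = {ξ ∈ 𝔤 | ξ_Q(q) ∈ 𝒟(q)}`. -/
def constraintAlgebra (q : Q) : Submodule ℝ (GroupLieAlgebra 𝓘(ℝ, EG) G) :=
  (S.constraint q).comap (generatorQ (EG := EG) (G := G) q).toLinearMap

/-- The nonholonomic momentum map `⟨J^nhc(v_q), ξ⟩ = ⟨𝔽L(v_q), ξ_Q(q)⟩` on `TQ`. -/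
def lagrangianMomentum (v : TangentBundle 𝓘(ℝ, E) Q) (ξ : GroupLieAlgebra 𝓘(ℝ, EG) G) : ℝ :=
  (S.legendre v).snd (generatorQ (EG := EG) (G := G) v.proj ξ)

end Lagrangian

end System
end Nonholonomic

end

open Nonholonomic

/-!
The momentum equation is the product rule combined with the Hamiltonian property of the canonical
momentum map. In charts of `Q` a cotangent lift is `(x, l) ↦ (φ_g x, l ∘ (Dφ_g x)⁻¹)`, and the
symmetry of the mixed partial derivatives of `(g, x) ↦ φ_g x` (`fderiv_momentum_eq`) gives
`dJ^ξ = ω(ξ_{T^*Q}, ·)` for a constant `ξ ∈ 𝔤` (`mfderiv_momentumCLM`). For a `𝔤`-valued function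
`ξ` on `M` the product rule adds the term `J^{X[ξ]}`, so that the left-hand side of the momentum
equation at `m` is `ω_M(ξ(m)_M, X)` (`System.momentumDefect_eq`). If `ξ(m)_M` is horizontal, then
pairing it with `(X, dh) ∈ D` turns this number into `-dh(ξ(m)_M)`, which vanishes as `h` is
invariant (`System.momentumDefect_eq_zero`).

The Lagrangian form follows by restriction to an integral curve: `J^nhc` and `ξ^𝒟` along the curve
are `J^ξ` and `ξ` composed with the curve. The curve is of second order because an element `(X, dH)`
of the Dirac structure can be tested on the horizontal vectors tangent to the fibres of `T^*Q`, the
velocities of the lines `t ↦ 𝔽L(v + t d)` with `d ∈ 𝒟`: there `dH` is `⟨d, v⟩` and `ω_M(X, ·)` is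
`⟨d, Tπ X⟩`, so `v - Tπ X`, which is in `𝒟`, is orthogonal to `𝒟` and hence zero
(`System.cotangentProjDeriv_eq_of_mem_diracStructure`). As `M` is an embedded submanifold, maps into
it are smooth when they are smooth as maps into `T^*Q`; this makes the action on `M` and the lines
above differentiable.
-/

noncomputable section

namespace Nonholonomic

/-! ### The charts of the cotangent bundle -/

section CotangentCharts

variable {E : Type*} [NormedAddCommGroup E] [NormedSpace ℝ E]
  {Q : Type*} [TopologicalSpace Q] [ChartedSpace E Q] [IsManifold 𝓘(ℝ, E) ∞ Q]

/-- The derivative at `q` of the preferred chart around `q₀`, as an endomorphism of the model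
space. -/
def chartFrame (q₀ q : Q) : E →L[ℝ] E :=
  mfderiv 𝓘(ℝ, E) 𝓘(ℝ, E) (extChartAt 𝓘(ℝ, E) q₀) q

/-- The derivative of the inverse of the preferred chart around `q₀`, at the point corresponding
to `q`; as an endomorphism of the model space. -/
def chartCoframe (q₀ q : Q) : E →L[ℝ] E :=
  mfderiv 𝓘(ℝ, E) 𝓘(ℝ, E) (extChartAt 𝓘(ℝ, E) q₀).symm (extChartAt 𝓘(ℝ, E) q₀ q)

theorem trivializationAt_symmL_eq {q₀ q : Q} (h : q ∈ (chartAt E q₀).source) :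
    ((trivializationAt E (TangentSpace 𝓘(ℝ, E)) q₀).symmL ℝ q : E →L[ℝ] E) =
      chartCoframe q₀ q := by
  have := TangentBundle.symmL_trivializationAt (I := 𝓘(ℝ, E)) h
  rw [ModelWithCorners.range_eq_univ, mfderivWithin_univ] at this
  exact this

theorem chartFrame_chartCoframe {q₀ q : Q} (h : q ∈ (chartAt E q₀).source) (w : E) :
    chartFrame q₀ q (chartCoframe q₀ q w) = w := by
  have h1 := (trivializationAt E (TangentSpace 𝓘(ℝ, E)) q₀).continuousLinearMapAt_symmL
    (R := ℝ) (b := q) h w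
  rw [TangentBundle.continuousLinearMapAt_trivializationAt h] at h1
  have h2 := trivializationAt_symmL_eq h
  exact (congrArg (fun l : E →L[ℝ] E => chartFrame q₀ q (l w)) h2).symm.trans h1

theorem chartCoframe_chartFrame {q₀ q : Q} (h : q ∈ (chartAt E q₀).source) (w : E) :
    chartCoframe q₀ q (chartFrame q₀ q w) = w := by
  have h1 := (trivializationAt E (TangentSpace 𝓘(ℝ, E)) q₀).symmL_continuousLinearMapAt
    (R := ℝ) (b := q) h w
  rw [TangentBundle.continuousLinearMapAt_trivializationAt h] at h1
  have h2 := trivializationAt_symmL_eq h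
  exact (congrArg (fun l : E →L[ℝ] E => l (chartFrame q₀ q w)) h2).symm.trans h1

/-- The covector `p`, read as a functional on the model space. (Tangent spaces are copies of the model
space; they are replaced by it wherever linear maps based at different points are composed.) -/
def covector (p : CotangentBundle E Q) : E →L[ℝ] ℝ := p.snd

/-- The components of a covector in the preferred chart around `q₀`. -/
def covectorCoord (q₀ : Q) (p : CotangentBundle E Q) : E →L[ℝ] ℝ :=
  (covector p).comp
    ((trivializationAt E (TangentSpace 𝓘(ℝ, E)) q₀).symmL ℝ p.proj : E →L[ℝ] E)

theorem covectorCoord_apply {q₀ : Q} {p : CotangentBundle E Q}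
    (h : p.proj ∈ (chartAt E q₀).source) (w : E) :
    covectorCoord q₀ p w = covector p (chartCoframe q₀ p.proj w) :=
  congrArg (fun l : E →L[ℝ] E => covector p (l w)) (trivializationAt_symmL_eq h)

theorem covectorCoord_chartFrame {q₀ : Q} {p : CotangentBundle E Q}
    (h : p.proj ∈ (chartAt E q₀).source) (w : E) :
    covectorCoord q₀ p (chartFrame q₀ p.proj w) = covector p w := by
  rw [covectorCoord_apply h, chartCoframe_chartFrame h]

/-- The preferred chart of `T^*Q` around `p` is the cotangent lift of the preferred chart of `Q`
around `π(p)`. -/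
theorem extChartAt_cotangent (p p' : CotangentBundle E Q) :
    extChartAt (cotangentModel E) p p' =
      (extChartAt 𝓘(ℝ, E) p.proj p'.proj, covectorCoord p.proj p') := by
  rw [FiberBundle.extChartAt]
  simp [hom_trivializationAt_apply, ContinuousLinearMap.inCoordinates]
  rfl

theorem mem_extChartAt_cotangent_source {p p' : CotangentBundle E Q} :
    p' ∈ (extChartAt (cotangentModel E) p).source ↔ p'.proj ∈ (chartAt E p.proj).source := by
  rw [FiberBundle.extChartAt]
  have h : (trivializationAt (E →L[ℝ] ℝ)
      (fun q : Q => TangentSpace 𝓘(ℝ, E) q →L[ℝ] ℝ) p.proj p').1 = p'.proj := rfl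
  simp [h]

/-- Smoothness of a map into `T^*Q` is smoothness of the base point and of the components. -/
theorem contMDiffAt_cotangent_iff {E' : Type*} [NormedAddCommGroup E'] [NormedSpace ℝ E']
    {H' : Type*} [TopologicalSpace H'] {I' : ModelWithCorners ℝ E' H'}
    {N : Type*} [TopologicalSpace N] [ChartedSpace H' N] {f : N → CotangentBundle E Q} {x : N}
    {n : WithTop ℕ∞} :
    ContMDiffAt I' (cotangentModel E) n f x ↔
      ContMDiffAt I' 𝓘(ℝ, E) n (fun y => (f y).proj) x ∧
        ContMDiffAt I' 𝓘(ℝ, E →L[ℝ] ℝ) n (fun y => covectorCoord (f x).proj (f y)) x := by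
  refine Bundle.contMDiffAt_totalSpace.trans (and_congr Iff.rfl ?_)
  simp [hom_trivializationAt_apply, ContinuousLinearMap.inCoordinates]
  rfl

theorem contMDiff_cotangent_proj :
    ContMDiff (cotangentModel E) 𝓘(ℝ, E) ∞ (fun p : CotangentBundle E Q => p.proj) :=
  Bundle.contMDiff_proj _

theorem contMDiffAt_covectorCoord (p : CotangentBundle E Q) :
    ContMDiffAt (cotangentModel E) 𝓘(ℝ, E →L[ℝ] ℝ) ∞ (covectorCoord p.proj) p :=
  (contMDiffAt_cotangent_iff.1 (contMDiffAt_id (x := p))).2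

/-- In the preferred charts, the canonical one-form is `(x, l) ↦ l dx`. -/
theorem chartPullback_canonicalOneForm (p : CotangentBundle E Q) {y : E × (E →L[ℝ] ℝ)}
    (hy : y ∈ (extChartAt (cotangentModel E) p).target) (v : E × (E →L[ℝ] ℝ)) :
    chartPullback (cotangentModel E) canonicalOneForm p y v = y.2 v.1 := by
  set p' := (extChartAt (cotangentModel E) p).symm y with hp'
  have hs : p'.proj ∈ (chartAt E p.proj).source :=
    mem_extChartAt_cotangent_source.1 ((extChartAt (cotangentModel E) p).map_target hy)
  have hΨ : (extChartAt 𝓘(ℝ, E) p.proj p'.proj, covectorCoord p.proj p') = y := by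
    rw [← extChartAt_cotangent, hp', (extChartAt (cotangentModel E) p).right_inv hy]
  have hsymm : MDifferentiableAt 𝓘(ℝ, E × (E →L[ℝ] ℝ)) (cotangentModel E)
      (extChartAt (cotangentModel E) p).symm y := by
    have := mdifferentiableWithinAt_extChartAt_symm hy
    rwa [ModelWithCorners.range_eq_univ, mdifferentiableWithinAt_univ] at this
  have hproj : MDifferentiableAt (cotangentModel E) 𝓘(ℝ, E)
      (fun p : CotangentBundle E Q => p.proj) p' :=
    contMDiff_cotangent_proj.mdifferentiable (by simp) p'
  have hcomp := mfderiv_comp y hproj hsymm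
  have heq : (fun p : CotangentBundle E Q => p.proj) ∘ (extChartAt (cotangentModel E) p).symm
      =ᶠ[𝓝 y] (extChartAt 𝓘(ℝ, E) p.proj).symm ∘ Prod.fst := by
    filter_upwards [(isOpen_extChartAt_target (I := cotangentModel E) p).mem_nhds hy] with z hz
    have h1 := mem_extChartAt_cotangent_source.1
      ((extChartAt (cotangentModel E) p).map_target hz)
    have h2 := (extChartAt_cotangent p _).symm.trans
      ((extChartAt (cotangentModel E) p).right_inv hz)
    have h3 := (extChartAt 𝓘(ℝ, E) p.proj).left_inv (by rwa [extChartAt_source])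
    simp only [Function.comp]
    exact h3.symm.trans (congrArg (fun z => (extChartAt 𝓘(ℝ, E) p.proj).symm z.1) h2)
  have hy1 : y.1 = extChartAt 𝓘(ℝ, E) p.proj p'.proj := (congrArg Prod.fst hΨ).symm
  have hφ : MDifferentiableAt 𝓘(ℝ, E) 𝓘(ℝ, E) (extChartAt 𝓘(ℝ, E) p.proj).symm y.1 := by
    have : y.1 ∈ (extChartAt 𝓘(ℝ, E) p.proj).target := by
      rw [hy1]; exact (extChartAt 𝓘(ℝ, E) p.proj).map_source (by rwa [extChartAt_source])
    have := mdifferentiableWithinAt_extChartAt_symm this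
    rwa [ModelWithCorners.range_eq_univ, mdifferentiableWithinAt_univ] at this
  have hfst : HasMFDerivAt 𝓘(ℝ, E × (E →L[ℝ] ℝ)) 𝓘(ℝ, E) Prod.fst y
    (ContinuousLinearMap.fst ℝ E (E →L[ℝ] ℝ)) := hasFDerivAt_fst.hasMFDerivAt
  have h5 := (hφ.hasMFDerivAt.comp y hfst).mfderiv
  rw [heq.mfderiv_eq, h5] at hcomp
  have h6 := congrArg (fun l : E × (E →L[ℝ] ℝ) →L[ℝ] E => covector p' (l v)) hcomp
  refine h6.symm.trans ?_
  have h7 := covectorCoord_apply hs v.1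
  have hy2 : covectorCoord p.proj p' = y.2 := congrArg Prod.snd hΨ
  rw [hy2, chartCoframe, ← hy1] at h7
  exact h7.symm

/-- The canonical symplectic form in the preferred charts, `dx ∧ dl`. -/
theorem canonicalForm_eq (p : CotangentBundle E Q) (u v : TangentSpace (cotangentModel E) p) :
    canonicalForm p u v =
      (chartDeriv (cotangentModel E) p v).2 (chartDeriv (cotangentModel E) p u).1 -
      (chartDeriv (cotangentModel E) p u).2 (chartDeriv (cotangentModel E) p v).1 := by
  have h : HasFDerivAt (chartPullback (cotangentModel E) canonicalOneForm p)
      (((ContinuousLinearMap.compL ℝ (E × (E →L[ℝ] ℝ)) E ℝ).flip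
        (ContinuousLinearMap.fst ℝ E (E →L[ℝ] ℝ))).comp
        (ContinuousLinearMap.snd ℝ E (E →L[ℝ] ℝ))) (extChartAt (cotangentModel E) p p) := by
    refine (ContinuousLinearMap.hasFDerivAt _).congr_of_eventuallyEq ?_
    filter_upwards [extChartAt_target_mem_nhds (I := cotangentModel E) p] with y hy
    refine ContinuousLinearMap.ext fun v => ?_
    exact chartPullback_canonicalOneForm p hy v
  unfold canonicalForm extDerivOneForm
  rw [h.fderiv]
  simp

end CotangentCharts

/-! ### The momentum equation in coordinates -/

section Calculus

variable {A E : Type*} [NormedAddCommGroup A] [NormedSpace ℝ A]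
  [NormedAddCommGroup E] [NormedSpace ℝ E]

/-- The Hamiltonian property of the momentum of a cotangent lifted action, in coordinates. Here `F`
is an action read in charts, `a₀` the coordinate of the neutral element, and `c` an orbit in
the cotangent bundle; `hc₂` says that `F (a, ·)` moves the covector `l₀` to `(c a).2`. -/
theorem fderiv_momentum_eq {F : A × E → E} {a₀ : A} {x₀ : E}
    (hF : ContDiffAt ℝ ∞ F (a₀, x₀)) (hid : ∀ᶠ x in 𝓝 x₀, F (a₀, x) = x)
    {c : A → E × (E →L[ℝ] ℝ)} (hc : DifferentiableAt ℝ c a₀)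
    (hc₁ : ∀ᶠ a in 𝓝 a₀, (c a).1 = F (a, x₀)) {l₀ : E →L[ℝ] ℝ}
    (hc₂ : ∀ᶠ a in 𝓝 a₀, ∀ w, (c a).2 (fderiv ℝ F (a, x₀) (0, w)) = l₀ w)
    (η : A) (u : E × (E →L[ℝ] ℝ)) :
    fderiv ℝ (fun z : E × (E →L[ℝ] ℝ) => z.2 (fderiv ℝ F (a₀, z.1) (η, 0))) (x₀, l₀) u =
      u.2 (fderiv ℝ c a₀ η).1 - (fderiv ℝ c a₀ η).2 u.1 := by
  have hF' : DifferentiableAt ℝ (fderiv ℝ F) (a₀, x₀) :=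
    (hF.fderiv_right (m := 1) (by norm_cast)).differentiableAt (by simp)
  have hF1 : DifferentiableAt ℝ F (a₀, x₀) := hF.differentiableAt (by simp)
  set D := fderiv ℝ (fderiv ℝ F) (a₀, x₀) with hD
  have hsymm : IsSymmSndFDerivAt ℝ F (a₀, x₀) := hF.isSymmSndFDerivAt (by simp; norm_cast)
  -- `F (a₀, ·)` is the identity, so its derivative is
  have hidw : ∀ w, fderiv ℝ F (a₀, x₀) (0, w) = w := by
    intro w
    have h1 : HasFDerivAt (fun x => F (a₀, x))
        ((fderiv ℝ F (a₀, x₀)).comp (ContinuousLinearMap.inr ℝ A E)) x₀ :=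
      hF1.hasFDerivAt.comp x₀ (hasFDerivAt_prodMk_right a₀ x₀)
    have h2 : HasFDerivAt (fun x => F (a₀, x)) (ContinuousLinearMap.id ℝ E) x₀ :=
      (hasFDerivAt_id x₀).congr_of_eventuallyEq hid
    simpa using congrArg (fun l : E →L[ℝ] E => l w) (h1.unique h2)
  have hl₀ : (c a₀).2 = l₀ := by
    ext w
    have := hc₂.self_of_nhds w
    rwa [hidw] at this
  -- the left-hand side
  have hz : HasFDerivAt (fun z : E × (E →L[ℝ] ℝ) => fderiv ℝ F (a₀, z.1))
      (D.comp ((ContinuousLinearMap.inr ℝ A E).comp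
        (ContinuousLinearMap.fst ℝ E (E →L[ℝ] ℝ)))) (x₀, l₀) :=
    hF'.hasFDerivAt.comp (x₀, l₀)
      ((hasFDerivAt_prodMk_right a₀ x₀).comp (x₀, l₀) (hasFDerivAt_fst (p := (x₀, l₀))))
  have hL := (hasFDerivAt_snd (𝕜 := ℝ) (p := (x₀, l₀))).clm_apply
    (hz.clm_apply (hasFDerivAt_const (η, (0 : E)) _))
  rw [hL.fderiv]
  -- the base point of the orbit
  have h1 : (fderiv ℝ c a₀ η).1 = fderiv ℝ F (a₀, x₀) (η, 0) := by
    have h1 : HasFDerivAt (fun a => F (a, x₀))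
        ((fderiv ℝ F (a₀, x₀)).comp (ContinuousLinearMap.inl ℝ A E)) a₀ :=
      hF1.hasFDerivAt.comp a₀ (hasFDerivAt_prodMk_left a₀ x₀)
    have h2 := (hc.hasFDerivAt.fst).congr_of_eventuallyEq (hc₁.mono fun a h => h.symm)
    simpa using congrArg (fun l => l η) (h2.unique h1)
  -- the covector of the orbit
  have h2 : (fderiv ℝ c a₀ η).2 u.1 + l₀ (D (η, 0) (0, u.1)) = 0 := by
    have h2 : HasFDerivAt (fun a => fderiv ℝ F (a, x₀))
        (D.comp (ContinuousLinearMap.inl ℝ A E)) a₀ :=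
      hF'.hasFDerivAt.comp a₀ (hasFDerivAt_prodMk_left a₀ x₀)
    have h3 := hc.hasFDerivAt.snd.clm_apply
      (h2.clm_apply (hasFDerivAt_const ((0 : A), u.1) a₀))
    have h4 := h3.unique ((hasFDerivAt_const (l₀ u.1) a₀).congr_of_eventuallyEq
      (hc₂.mono fun a h => h u.1))
    have := congrArg (fun l => l η) h4
    simp [hidw, hl₀] at this
    linarith
  have h3 := hsymm.eq (0, u.1) (η, 0)
  simp only [← hD] at h3
  simp [h1, h3]
  linarith

end Calculus

/-! ### The cotangent lifted action and its momentum map -/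

section Action

variable {E : Type*} [NormedAddCommGroup E] [NormedSpace ℝ E]
  {Q : Type*} [TopologicalSpace Q] [ChartedSpace E Q]
  {EG : Type*} [NormedAddCommGroup EG] [NormedSpace ℝ EG]
  {G : Type*} [TopologicalSpace G] [ChartedSpace EG G] [Group G]
  [MulAction G Q]

variable (EG G) in
/-- The action of `G` on `Q`, read in the preferred charts around `1` and `q₀`. -/
def actionInCharts (q₀ : Q) (z : EG × E) : E :=
  extChartAt 𝓘(ℝ, E) q₀
    ((extChartAt 𝓘(ℝ, EG) (1 : G)).symm z.1 • (extChartAt 𝓘(ℝ, E) q₀).symm z.2)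

variable (EG G) in
/-- The coordinate of the neutral element. -/
def oneCoord : EG := extChartAt 𝓘(ℝ, EG) (1 : G) 1

variable (EG G) in
/-- The derivative of the preferred chart of `G` around `1`. -/
def oneFrame : EG →L[ℝ] EG :=
  mfderiv 𝓘(ℝ, EG) 𝓘(ℝ, EG) (extChartAt 𝓘(ℝ, EG) (1 : G)) 1

variable (EG G) in
/-- The map `ξ ↦ ξ_Q(q)`, with values in the model space. -/
def generatorCLM (q : Q) : EG →L[ℝ] E :=
  generatorQ (EG := EG) (G := G) (E := E) q

variable (E) in
/-- The tangent map of `q ↦ g • q`, as an endomorphism of the model space. -/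
def tangentCLM (g : G) (q : Q) : E →L[ℝ] E :=
  tangentAction g q

theorem actionInCharts_apply {q₀ : Q} {g : G} {q : Q} (hg : g ∈ (chartAt EG (1 : G)).source)
    (hq : q ∈ (chartAt E q₀).source) :
    actionInCharts EG G q₀ (extChartAt 𝓘(ℝ, EG) (1 : G) g, extChartAt 𝓘(ℝ, E) q₀ q) =
      extChartAt 𝓘(ℝ, E) q₀ (g • q) := by
  unfold actionInCharts
  rw [(extChartAt 𝓘(ℝ, EG) (1 : G)).left_inv (by rwa [extChartAt_source]),
    (extChartAt 𝓘(ℝ, E) q₀).left_inv (by rwa [extChartAt_source])]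

theorem eventually_actionInCharts_one (q₀ : Q) :
    ∀ᶠ x in 𝓝 (extChartAt 𝓘(ℝ, E) q₀ q₀), actionInCharts EG G q₀ (oneCoord EG G, x) = x := by
  filter_upwards [extChartAt_target_mem_nhds (I := 𝓘(ℝ, E)) q₀] with x hx
  unfold actionInCharts oneCoord
  simp only
  rw [extChartAt_to_inv, one_smul, (extChartAt 𝓘(ℝ, E) q₀).right_inv hx]

variable [ContMDiffSMul 𝓘(ℝ, EG) 𝓘(ℝ, E) ∞ G Q]

theorem contMDiff_orbit (q : Q) : ContMDiff 𝓘(ℝ, EG) 𝓘(ℝ, E) ∞ (fun g : G => g • q) :=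
  (contMDiff_smul (I := 𝓘(ℝ, EG)) (I' := 𝓘(ℝ, E)) (n := ∞) (G := G) (M := Q)).comp
    (contMDiff_id.prodMk contMDiff_const)

theorem eventually_smul_mem_source (EG : Type*) [NormedAddCommGroup EG] [NormedSpace ℝ EG]
    [ChartedSpace EG G] [ContMDiffSMul 𝓘(ℝ, EG) 𝓘(ℝ, E) ∞ G Q]
    {q₀ q : Q} (hq : q ∈ (chartAt E q₀).source) :
    ∀ᶠ g in 𝓝 (1 : G), g ∈ (chartAt EG (1 : G)).source ∧ g • q ∈ (chartAt E q₀).source := by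
  have h1 : ∀ᶠ g in 𝓝 (1 : G), g ∈ (chartAt EG (1 : G)).source :=
    (chartAt EG (1 : G)).open_source.mem_nhds (mem_chart_source EG 1)
  have h2 : ContinuousAt (fun g : G => g • q) 1 :=
    (contMDiff_orbit (EG := EG) (E := E) q).continuous.continuousAt
  have h3 : ∀ᶠ g in 𝓝 (1 : G), g • q ∈ (chartAt E q₀).source :=
    h2 ((chartAt E q₀).open_source.mem_nhds (by simpa using hq))
  exact h1.and h3

variable [IsManifold 𝓘(ℝ, E) ∞ Q] [LieGroup 𝓘(ℝ, EG) ∞ G]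

theorem contDiffAt_actionInCharts {q₀ : Q} {g : G} {q : Q}
    (hg : g ∈ (chartAt EG (1 : G)).source)
    (hq : q ∈ (chartAt E q₀).source) (hgq : g • q ∈ (chartAt E q₀).source) :
    ContDiffAt ℝ ∞ (actionInCharts EG G q₀)
      (extChartAt 𝓘(ℝ, EG) (1 : G) g, extChartAt 𝓘(ℝ, E) q₀ q) := by
  rw [← contMDiffAt_iff_contDiffAt]
  have hg' : g ∈ (extChartAt 𝓘(ℝ, EG) (1 : G)).source := by rwa [extChartAt_source]
  have hq' : q ∈ (extChartAt 𝓘(ℝ, E) q₀).source := by rwa [extChartAt_source]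
  have h1 : ContMDiffAt 𝓘(ℝ, EG × E) 𝓘(ℝ, EG) ∞
      (fun z : EG × E => (extChartAt 𝓘(ℝ, EG) (1 : G)).symm z.1)
      (extChartAt 𝓘(ℝ, EG) (1 : G) g, extChartAt 𝓘(ℝ, E) q₀ q) :=
    ((contMDiffOn_extChartAt_symm (1 : G)).contMDiffAt
      (extChartAt_target_mem_nhds' ((extChartAt 𝓘(ℝ, EG) (1 : G)).map_source hg'))).comp
      (extChartAt 𝓘(ℝ, EG) (1 : G) g, extChartAt 𝓘(ℝ, E) q₀ q) contDiffAt_fst.contMDiffAt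
  have h2 : ContMDiffAt 𝓘(ℝ, EG × E) 𝓘(ℝ, E) ∞
      (fun z : EG × E => (extChartAt 𝓘(ℝ, E) q₀).symm z.2)
      (extChartAt 𝓘(ℝ, EG) (1 : G) g, extChartAt 𝓘(ℝ, E) q₀ q) :=
    ((contMDiffOn_extChartAt_symm q₀).contMDiffAt
      (extChartAt_target_mem_nhds' ((extChartAt 𝓘(ℝ, E) q₀).map_source hq'))).comp
      (extChartAt 𝓘(ℝ, EG) (1 : G) g, extChartAt 𝓘(ℝ, E) q₀ q) contDiffAt_snd.contMDiffAt
  have h3 := h1.smul h2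
  refine ContMDiffAt.comp_of_eq (y := g • q) ?_ h3 ?_
  · exact contMDiffAt_extChartAt' hgq
  · simp only
    rw [(extChartAt 𝓘(ℝ, EG) (1 : G)).left_inv hg', (extChartAt 𝓘(ℝ, E) q₀).left_inv hq']

/-- The infinitesimal generator in coordinates. -/
theorem chartFrame_generatorQ {q₀ q : Q} (hq : q ∈ (chartAt E q₀).source)
    (ξ : EG) :
    chartFrame q₀ q (generatorCLM EG G q ξ) =
      fderiv ℝ (actionInCharts EG G q₀) (oneCoord EG G, extChartAt 𝓘(ℝ, E) q₀ q)
        (oneFrame EG G ξ, 0) := by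
  have h1 : HasMFDerivAt 𝓘(ℝ, E) 𝓘(ℝ, E) (extChartAt 𝓘(ℝ, E) q₀) ((1 : G) • q)
      (mfderiv 𝓘(ℝ, E) 𝓘(ℝ, E) (extChartAt 𝓘(ℝ, E) q₀) ((1 : G) • q)) :=
    (mdifferentiableAt_extChartAt (by simpa using hq)).hasMFDerivAt
  have h2 : HasMFDerivAt 𝓘(ℝ, EG) 𝓘(ℝ, E) (fun g : G => g • q) 1 _ :=
    ((contMDiff_orbit (EG := EG) q).mdifferentiable (by simp) 1).hasMFDerivAt
  have h3 := h1.comp 1 h2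
  have h4 : HasMFDerivAt 𝓘(ℝ, EG) 𝓘(ℝ, EG) (extChartAt 𝓘(ℝ, EG) (1 : G)) 1 (oneFrame EG G) :=
    (mdifferentiableAt_extChartAt (mem_chart_source EG 1)).hasMFDerivAt
  have h0 : HasFDerivAt (actionInCharts EG G q₀)
      (fderiv ℝ (actionInCharts EG G q₀) (oneCoord EG G, extChartAt 𝓘(ℝ, E) q₀ q))
      (oneCoord EG G, extChartAt 𝓘(ℝ, E) q₀ q) :=
    ((contDiffAt_actionInCharts (mem_chart_source EG (1 : G)) hq
      (by simpa using hq)).differentiableAt (by simp)).hasFDerivAt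
  have h5 := HasFDerivAt.comp (oneCoord EG G) h0
    (hasFDerivAt_prodMk_left (𝕜 := ℝ) (oneCoord EG G) (extChartAt 𝓘(ℝ, E) q₀ q))
  have h6 := (HasMFDerivAt.comp (1 : G) (h5.hasMFDerivAt) h4).congr_of_eventuallyEq
    (f₁ := fun g : G => extChartAt 𝓘(ℝ, E) q₀ (g • q))
    ((eventually_smul_mem_source EG hq).mono fun g hg => (actionInCharts_apply hg.1 hq).symm)
  have h7 := congrArg (fun l : EG →L[ℝ] E => l ξ) (hasMFDerivAt_unique h3 h6)
  have h8 : chartFrame q₀ ((1 : G) • q) (generatorCLM EG G q ξ) = _ := h7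
  rw [one_smul] at h8
  exact h8

/-- The momentum map in coordinates. -/
theorem momentumMap_eq {q₀ : Q} {p : CotangentBundle E Q} (hp : p.proj ∈ (chartAt E q₀).source)
    (ξ : EG) :
    momentumMap (EG := EG) (G := G) p ξ = covectorCoord q₀ p
      (fderiv ℝ (actionInCharts EG G q₀) (oneCoord EG G, extChartAt 𝓘(ℝ, E) q₀ p.proj)
        (oneFrame EG G ξ, 0)) := by
  rw [← chartFrame_generatorQ hp, covectorCoord_chartFrame hp]
  rfl

/-- The tangent action in coordinates. -/
theorem chartFrame_tangentAction {q₀ q : Q} {g : G} (hg : g ∈ (chartAt EG (1 : G)).source)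
    (hq : q ∈ (chartAt E q₀).source) (hgq : g • q ∈ (chartAt E q₀).source) (w : E) :
    chartFrame q₀ (g • q) (tangentCLM E g q w) =
      fderiv ℝ (actionInCharts EG G q₀)
        (extChartAt 𝓘(ℝ, EG) (1 : G) g, extChartAt 𝓘(ℝ, E) q₀ q) (0, chartFrame q₀ q w) := by
  have h1 : HasMFDerivAt 𝓘(ℝ, E) 𝓘(ℝ, E) (extChartAt 𝓘(ℝ, E) q₀) (g • q)
      (chartFrame (E := E) q₀ (g • q)) :=
    (mdifferentiableAt_extChartAt hgq).hasMFDerivAt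
  have h2 : HasMFDerivAt 𝓘(ℝ, E) 𝓘(ℝ, E) (fun q : Q => g • q) q (tangentCLM E g q) :=
    ((ContMDiffSMul.contMDiff_const_smul (I := 𝓘(ℝ, EG)) (n := ∞) g).mdifferentiable
      (by simp) q).hasMFDerivAt
  have h3 := h1.comp q h2
  have h4 : HasMFDerivAt 𝓘(ℝ, E) 𝓘(ℝ, E) (extChartAt 𝓘(ℝ, E) q₀) q
      (chartFrame (E := E) q₀ q) :=
    (mdifferentiableAt_extChartAt hq).hasMFDerivAt
  have h5 : HasFDerivAt (fun x => actionInCharts EG G q₀ (extChartAt 𝓘(ℝ, EG) (1 : G) g, x))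
      ((fderiv ℝ (actionInCharts EG G q₀)
        (extChartAt 𝓘(ℝ, EG) (1 : G) g, extChartAt 𝓘(ℝ, E) q₀ q)).comp
        (ContinuousLinearMap.inr ℝ EG E)) (extChartAt 𝓘(ℝ, E) q₀ q) :=
    ((contDiffAt_actionInCharts hg hq hgq).differentiableAt (by simp)).hasFDerivAt.comp _
      (hasFDerivAt_prodMk_right _ _)
  have h6 := (HasMFDerivAt.comp q (h5.hasMFDerivAt) h4).congr_of_eventuallyEq
    (f₁ := fun q : Q => extChartAt 𝓘(ℝ, E) q₀ (g • q)) (by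
      filter_upwards [(chartAt E q₀).open_source.mem_nhds hq] with q' hq'
      exact (actionInCharts_apply hg hq').symm)
  exact congrArg (fun l : E →L[ℝ] E => l w) (hasMFDerivAt_unique h3 h6)

end Action

section CotangentLift

variable {E : Type*} [NormedAddCommGroup E] [NormedSpace ℝ E]
  {Q : Type*} [TopologicalSpace Q] [ChartedSpace E Q] {G : Type*} [Group G] [MulAction G Q]

theorem tangentCLM_inv_tangentCLM (EG : Type*) [NormedAddCommGroup EG] [NormedSpace ℝ EG]
    [TopologicalSpace G] [ChartedSpace EG G] [ContMDiffSMul 𝓘(ℝ, EG) 𝓘(ℝ, E) ∞ G Q]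
    (g : G) (q : Q) (w : E) :
    tangentCLM E g⁻¹ (g • q) (tangentCLM E g q w) = w := by
  have h : tangentCLM E g⁻¹ (g • q) (tangentCLM E g⁻¹⁻¹ (g⁻¹ • (g • q)) w) = w :=
    tangentAction_tangentAction_inv (EG := EG) g⁻¹ (g • q) w
  rwa [inv_inv, inv_smul_smul] at h

theorem cotangentLift_one (p : CotangentBundle E Q) : cotangentLift (1 : G) p = p := by
  have h1 : ∀ q : Q, tangentCLM E (1 : G) q = ContinuousLinearMap.id ℝ E := by
    intro q
    have h : (fun x : Q => (1 : G) • x) = id := by ext; simp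
    unfold tangentCLM tangentAction
    rw [h]
    exact mfderiv_id
  have h2 : ∀ q : Q, q = p.proj → (⟨q, (covector p).comp (tangentCLM E (1 : G)⁻¹ q)⟩ :
      CotangentBundle E Q) = p := by
    rintro _ rfl
    rw [inv_one, h1]
    rfl
  exact h2 _ (one_smul G p.proj)

theorem covector_cotangentLift (g : G) (p : CotangentBundle E Q) :
    covector (cotangentLift g p) = (covector p).comp (tangentCLM E g⁻¹ (g • p.proj)) :=
  rfl

end CotangentLift

section MomentumMap

variable {E : Type*} [NormedAddCommGroup E] [NormedSpace ℝ E]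
  {Q : Type*} [TopologicalSpace Q] [ChartedSpace E Q] [IsManifold 𝓘(ℝ, E) ∞ Q]
  {EG : Type*} [NormedAddCommGroup EG] [NormedSpace ℝ EG]
  {G : Type*} [TopologicalSpace G] [ChartedSpace EG G] [Group G]
  [MulAction G Q]

variable (EG G) in
/-- The value `ξ ↦ ⟨J(p), ξ⟩` of the momentum map at `p`, as a functional on the Lie algebra. -/
def momentumCLM (p : CotangentBundle E Q) : EG →L[ℝ] ℝ :=
  (covector p).comp (generatorCLM EG G p.proj)

variable [LieGroup 𝓘(ℝ, EG) ∞ G] [ContMDiffSMul 𝓘(ℝ, EG) 𝓘(ℝ, E) ∞ G Q]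

theorem contDiffAt_fderiv_actionInCharts {q₀ q : Q} {g : G}
    (hg : g ∈ (chartAt EG (1 : G)).source) (hq : q ∈ (chartAt E q₀).source)
    (hgq : g • q ∈ (chartAt E q₀).source) :
    ContDiffAt ℝ ∞ (fderiv ℝ (actionInCharts EG G q₀))
      (extChartAt 𝓘(ℝ, EG) (1 : G) g, extChartAt 𝓘(ℝ, E) q₀ q) :=
  (contDiffAt_actionInCharts hg hq hgq).fderiv_right (by simp)

theorem contMDiff_momentumCLM :
    ContMDiff (cotangentModel E) 𝓘(ℝ, EG →L[ℝ] ℝ) ∞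
      (momentumCLM EG G : CotangentBundle E Q → EG →L[ℝ] ℝ) := by
  intro p
  have hp := mem_chart_source E p.proj
  have h1 : ContMDiffAt (cotangentModel E) 𝓘(ℝ, E) ∞
      (fun p' : CotangentBundle E Q => extChartAt 𝓘(ℝ, E) p.proj p'.proj) p :=
    contMDiffAt_extChartAt.comp p contMDiff_cotangent_proj.contMDiffAt
  have h3 : ContMDiffAt (cotangentModel E) 𝓘(ℝ, EG × E →L[ℝ] E) ∞
      (fun p' : CotangentBundle E Q => fderiv ℝ (actionInCharts EG G p.proj)
        (oneCoord EG G, extChartAt 𝓘(ℝ, E) p.proj p'.proj)) p :=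
    ContMDiffAt.comp_of_eq (contDiffAt_fderiv_actionInCharts
      (mem_chart_source EG (1 : G)) hp (by simp)).contMDiffAt
      (contMDiffAt_const.prodMk_space h1) rfl
  have h4 := (contMDiffAt_covectorCoord p).clm_comp (h3.clm_comp
    (contMDiffAt_const (c := (ContinuousLinearMap.inl ℝ EG E).comp (oneFrame EG G))))
  refine h4.congr_of_eventuallyEq ?_
  have h5 : ∀ᶠ p' : CotangentBundle E Q in 𝓝 p, p'.proj ∈ (chartAt E p.proj).source :=
    contMDiff_cotangent_proj.continuous.continuousAt
      ((chartAt E p.proj).open_source.mem_nhds hp)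
  filter_upwards [h5] with p' hp'
  ext ξ
  exact momentumMap_eq hp' ξ

/-- The covector components of an orbit of the cotangent lifted action, in terms of the action read
in charts. -/
theorem covectorCoord_cotangentLift {q₀ : Q} {p : CotangentBundle E Q} {g : G}
    (hg : g⁻¹ ∈ (chartAt EG (1 : G)).source) (hp : p.proj ∈ (chartAt E q₀).source)
    (hgp : g • p.proj ∈ (chartAt E q₀).source) (w : E) :
    covectorCoord q₀ (cotangentLift g p) w = covectorCoord q₀ p
      (fderiv ℝ (actionInCharts EG G q₀) (extChartAt 𝓘(ℝ, EG) (1 : G) g⁻¹,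
        extChartAt 𝓘(ℝ, E) q₀ (g • p.proj)) (0, w)) := by
  have h1 := chartFrame_tangentAction (q := g • p.proj) hg hgp (by simpa using hp)
    (chartCoframe q₀ (g • p.proj) w)
  rw [chartFrame_chartCoframe hgp, inv_smul_smul] at h1
  rw [← h1, covectorCoord_chartFrame hp,
    covectorCoord_apply (p := cotangentLift g p) (q₀ := q₀) hgp]
  rfl

theorem covectorCoord_cotangentLift_fderiv
    {q₀ : Q} {p : CotangentBundle E Q} {g : G}
    (hg : g ∈ (chartAt EG (1 : G)).source) (hp : p.proj ∈ (chartAt E q₀).source)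
    (hgp : g • p.proj ∈ (chartAt E q₀).source) (w : E) :
    covectorCoord q₀ (cotangentLift g p)
      (fderiv ℝ (actionInCharts EG G q₀) (extChartAt 𝓘(ℝ, EG) (1 : G) g,
        extChartAt 𝓘(ℝ, E) q₀ p.proj) (0, w)) = covectorCoord q₀ p w := by
  have h1 := chartFrame_tangentAction hg hp hgp (chartCoframe q₀ p.proj w)
  rw [chartFrame_chartCoframe hp] at h1
  rw [← h1]
  refine (covectorCoord_chartFrame (p := cotangentLift g p) (q₀ := q₀) hgp _).trans ?_
  rw [covector_cotangentLift, ContinuousLinearMap.comp_apply,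
    tangentCLM_inv_tangentCLM EG, covectorCoord_apply hp]

theorem contMDiffAt_cotangentLift (p : CotangentBundle E Q) :
    ContMDiffAt 𝓘(ℝ, EG) (cotangentModel E) ∞ (fun g : G => cotangentLift g p) 1 := by
  have hp := mem_chart_source E p.proj
  refine contMDiffAt_cotangent_iff.2 ⟨(contMDiff_orbit p.proj).contMDiffAt, ?_⟩
  rw [cotangentLift_one]
  have h1 : ContMDiffAt 𝓘(ℝ, EG) 𝓘(ℝ, EG) ∞
      (fun g : G => extChartAt 𝓘(ℝ, EG) (1 : G) g⁻¹) 1 :=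
    ContMDiffAt.comp_of_eq contMDiffAt_extChartAt (contMDiff_inv 𝓘(ℝ, EG) ∞).contMDiffAt
      inv_one
  have h2 : ContMDiffAt 𝓘(ℝ, EG) 𝓘(ℝ, E) ∞
      (fun g : G => extChartAt 𝓘(ℝ, E) p.proj (g • p.proj)) 1 :=
    ContMDiffAt.comp_of_eq contMDiffAt_extChartAt (contMDiff_orbit p.proj).contMDiffAt
      (one_smul G _)
  have h3 : ContMDiffAt 𝓘(ℝ, EG) 𝓘(ℝ, EG × E →L[ℝ] E) ∞
      (fun g : G => fderiv ℝ (actionInCharts EG G p.proj)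
        (extChartAt 𝓘(ℝ, EG) (1 : G) g⁻¹, extChartAt 𝓘(ℝ, E) p.proj (g • p.proj))) 1 := by
    refine ContMDiffAt.comp_of_eq (contDiffAt_fderiv_actionInCharts
      (mem_chart_source EG (1 : G)) hp (by simp)).contMDiffAt
      (h1.prodMk_space h2) (by simp)
  have h4 := (contMDiffAt_const (c := covectorCoord p.proj p)).clm_comp (h3.clm_comp
    (contMDiffAt_const (c := ContinuousLinearMap.inr ℝ EG E)))
  refine h4.congr_of_eventuallyEq ?_
  have h5 : ∀ᶠ g in 𝓝 (1 : G), g⁻¹ ∈ (chartAt EG (1 : G)).source :=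
    (contMDiff_inv 𝓘(ℝ, EG) ∞).continuous.continuousAt
      ((chartAt EG (1 : G)).open_source.mem_nhds (by simp))
  filter_upwards [h5, eventually_smul_mem_source EG hp] with g hg hg'
  refine ContinuousLinearMap.ext fun w => ?_
  exact covectorCoord_cotangentLift hg hp hg'.2 w

/-- The cotangent lifted action is Hamiltonian: `dJ^ξ = ω(ξ_{T^*Q}, ·)`. -/
theorem mfderiv_momentumCLM (p : CotangentBundle E Q) (ξ : EG)
    (u : TangentSpace (cotangentModel E) p) :
    (mfderiv (cotangentModel E) 𝓘(ℝ, ℝ)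
      (fun p' : CotangentBundle E Q => momentumCLM EG G p' ξ) p u : ℝ) =
      canonicalForm p (infinitesimalGenerator (cotangentModel E)
        (cotangentLift : G → CotangentBundle E Q → CotangentBundle E Q) p ξ) u := by
  have hp : p.proj ∈ (chartAt E p.proj).source := mem_chart_source E p.proj
  set F : EG × E → E := actionInCharts EG G p.proj with hF
  set Ψ := extChartAt (cotangentModel E) p with hΨ
  set χ := extChartAt 𝓘(ℝ, EG) (1 : G) with hχ
  set c : EG → E × (E →L[ℝ] ℝ) := fun a => Ψ (cotangentLift (χ.symm a) p) with hc
  have hχ1 : χ.symm (oneCoord EG G) = 1 := extChartAt_to_inv (I := 𝓘(ℝ, EG)) (1 : G)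
  have hΨp : Ψ p = (extChartAt 𝓘(ℝ, E) p.proj p.proj, covectorCoord p.proj p) :=
    extChartAt_cotangent p p
  have hχs : ∀ᶠ a in 𝓝 (oneCoord EG G), a ∈ χ.target :=
    extChartAt_target_mem_nhds (I := 𝓘(ℝ, EG)) (1 : G)
  have hsrc : ∀ᶠ a in 𝓝 (oneCoord EG G), χ.symm a ∈ (chartAt EG (1 : G)).source ∧
      χ.symm a • p.proj ∈ (chartAt E p.proj).source := by
    have h : ContinuousAt χ.symm (oneCoord EG G) := continuousAt_extChartAt_symm (1 : G)
    rw [ContinuousAt, hχ1] at h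
    exact h.eventually (eventually_smul_mem_source EG hp)
  -- the orbit in coordinates is differentiable
  have hΨd : MDifferentiableAt (cotangentModel E) 𝓘(ℝ, E × (E →L[ℝ] ℝ)) Ψ p :=
    mdifferentiableAt_extChartAt (mem_chart_source _ p)
  have horb : MDifferentiableAt 𝓘(ℝ, EG) (cotangentModel E)
      (fun g : G => cotangentLift g p) 1 :=
    (contMDiffAt_cotangentLift p).mdifferentiableAt (by simp)
  have hcd : DifferentiableAt ℝ c (oneCoord EG G) := by
    rw [← mdifferentiableAt_iff_differentiableAt]
    have h1 : MDifferentiableAt 𝓘(ℝ, EG) 𝓘(ℝ, EG) χ.symm (oneCoord EG G) :=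
      ((contMDiffOn_extChartAt_symm (n := ∞) (1 : G)).contMDiffAt hχs).mdifferentiableAt (by simp)
    have h2 := MDifferentiableAt.comp_of_eq (f := χ.symm) (x := oneCoord EG G) horb h1 hχ1
    exact MDifferentiableAt.comp_of_eq (oneCoord EG G) hΨd h2
      (by simp [hχ1, cotangentLift_one])
  -- the generator in coordinates
  have hgen : fderiv ℝ c (oneCoord EG G) (oneFrame EG G ξ) =
      chartDeriv (cotangentModel E) p (infinitesimalGenerator (cotangentModel E)
        (cotangentLift : G → CotangentBundle E Q → CotangentBundle E Q) p ξ) := by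
    have h1 : HasMFDerivAt 𝓘(ℝ, EG) 𝓘(ℝ, EG) χ 1 (oneFrame EG G) :=
      (mdifferentiableAt_extChartAt (mem_chart_source EG 1)).hasMFDerivAt
    have h2 := (HasMFDerivAt.comp (1 : G) hcd.hasFDerivAt.hasMFDerivAt h1).congr_of_eventuallyEq
      (f₁ := fun g : G => Ψ (cotangentLift g p)) (by
        filter_upwards [(chartAt EG (1 : G)).open_source.mem_nhds (mem_chart_source EG 1)]
          with g hg
        simp only [hc, Function.comp]
        rw [χ.left_inv (by rwa [hχ, extChartAt_source])])
    have h3 : HasMFDerivAt (cotangentModel E) 𝓘(ℝ, E × (E →L[ℝ] ℝ)) Ψ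
        (cotangentLift (1 : G) p) (mfderiv (cotangentModel E) 𝓘(ℝ, E × (E →L[ℝ] ℝ)) Ψ
        (cotangentLift (1 : G) p)) := by
      rw [cotangentLift_one]
      exact hΨd.hasMFDerivAt
    have h4 := h3.comp (1 : G) horb.hasMFDerivAt
    have h5 := congrArg (fun l : EG →L[ℝ] E × (E →L[ℝ] ℝ) => l ξ) (hasMFDerivAt_unique h2 h4)
    have h6 : ∀ p' : CotangentBundle E Q, p' = p → ∀ v : E × (E →L[ℝ] ℝ),
      (mfderiv (cotangentModel E) 𝓘(ℝ, E × (E →L[ℝ] ℝ)) Ψ p' :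
        E × (E →L[ℝ] ℝ) →L[ℝ] E × (E →L[ℝ] ℝ)) v = chartDeriv (cotangentModel E) p v := by
      rintro _ rfl v; rfl
    exact h5.trans (h6 _ (cotangentLift_one p) _)
  -- the momentum in coordinates
  have hFd : ContDiffAt ℝ ∞ F (oneCoord EG G, extChartAt 𝓘(ℝ, E) p.proj p.proj) :=
    contDiffAt_actionInCharts (mem_chart_source EG (1 : G)) hp (by simp)
  have hj : DifferentiableAt ℝ (fun z : E × (E →L[ℝ] ℝ) =>
      z.2 (fderiv ℝ F (oneCoord EG G, z.1) (oneFrame EG G ξ, 0))) (Ψ p) := by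
    have h1 : DifferentiableAt ℝ (fderiv ℝ F)
        (oneCoord EG G, (Ψ p).1) := by
      rw [hΨp]
      exact (hFd.fderiv_right (m := 1) (by norm_cast)).differentiableAt (by simp)
    have h2 : DifferentiableAt ℝ (fun z : E × (E →L[ℝ] ℝ) => fderiv ℝ F (oneCoord EG G, z.1))
        (Ψ p) :=
      DifferentiableAt.comp (g := fderiv ℝ F)
        (f := fun z : E × (E →L[ℝ] ℝ) => (oneCoord EG G, z.1)) (Ψ p) h1 (by fun_prop)
    fun_prop
  have hJ := (HasMFDerivAt.comp p hj.hasFDerivAt.hasMFDerivAt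
    hΨd.hasMFDerivAt).congr_of_eventuallyEq
    (f₁ := fun p' : CotangentBundle E Q => momentumCLM EG G p' ξ) (by
      have h5 : ∀ᶠ p' : CotangentBundle E Q in 𝓝 p, p'.proj ∈ (chartAt E p.proj).source :=
        contMDiff_cotangent_proj.continuous.continuousAt
          ((chartAt E p.proj).open_source.mem_nhds hp)
      filter_upwards [h5] with p' hp'
      simp only [Function.comp, hΨ, extChartAt_cotangent]
      exact momentumMap_eq hp' ξ)
  rw [hJ.mfderiv, canonicalForm_eq, ← hgen]
  have hkey := fderiv_momentum_eq hFd (eventually_actionInCharts_one p.proj) hcd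
    (by
      filter_upwards [hsrc, hχs] with a ha ha'
      simp only [hc, hΨ, extChartAt_cotangent]
      have := actionInCharts_apply ha.1 hp
      rw [← hχ, χ.right_inv ha'] at this
      exact this.symm) (l₀ := covectorCoord p.proj p)
    (by
      filter_upwards [hsrc, hχs] with a ha ha' w
      simp only [hc, hΨ, extChartAt_cotangent]
      have := covectorCoord_cotangentLift_fderiv ha.1 hp ha.2 w
      rwa [← hχ, χ.right_inv ha'] at this) (oneFrame EG G ξ)
    (chartDeriv (cotangentModel E) p u)
  rw [← hΨp] at hkey
  exact hkey

end MomentumMap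

/-! ### The symmetry action on the constraint manifold -/

/-- The product rule for the evaluation of a family of functionals on a family of vectors. -/
theorem hasMFDerivAt_clm_apply {A N F : Type*} [NormedAddCommGroup A] [NormedSpace ℝ A]
    [TopologicalSpace N] [ChartedSpace A N] [NormedAddCommGroup F] [NormedSpace ℝ F]
    {f : N → F →L[ℝ] ℝ} {g : N → F} {x : N} {f' : A →L[ℝ] F →L[ℝ] ℝ} {g' : A →L[ℝ] F}
    (hf : HasMFDerivAt 𝓘(ℝ, A) 𝓘(ℝ, F →L[ℝ] ℝ) f x f') (hg : HasMFDerivAt 𝓘(ℝ, A) 𝓘(ℝ, F) g x g') :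
    HasMFDerivAt 𝓘(ℝ, A) 𝓘(ℝ, ℝ) (fun y => f y (g y)) x
      ((f x).comp g' + f'.flip (g x) : A →L[ℝ] ℝ) := by
  refine ⟨hf.1.clm_apply hg.1, ?_⟩
  have hf' : HasFDerivWithinAt (fun y => f ((extChartAt 𝓘(ℝ, A) x).symm y)) f'
    (Set.range 𝓘(ℝ, A)) (extChartAt 𝓘(ℝ, A) x x) := hf.2
  have hg' : HasFDerivWithinAt (fun y => g ((extChartAt 𝓘(ℝ, A) x).symm y)) g'
    (Set.range 𝓘(ℝ, A)) (extChartAt 𝓘(ℝ, A) x x) := hg.2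
  have h := hf'.clm_apply hg'
  simp only [extChartAt_to_inv] at h
  exact h

namespace System

variable {E : Type*} [NormedAddCommGroup E] [NormedSpace ℝ E]
  {Q : Type*} [TopologicalSpace Q] [ChartedSpace E Q] [IsManifold 𝓘(ℝ, E) ∞ Q] {k : ℕ}
  {S : System E Q k}
  {EM : Type*} [NormedAddCommGroup EM] [NormedSpace ℝ EM]
  [ChartedSpace EM S.constraintManifold]

/-- A map into the embedded submanifold `M` is smooth if it is smooth as a map into `T^*Q`. -/
theorem contMDiffAt_constraintManifold [IsManifold 𝓘(ℝ, EM) ∞ S.constraintManifold]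
    (hM : IsSmoothEmbedding 𝓘(ℝ, EM) (cotangentModel E) ∞
      (Subtype.val : S.constraintManifold → CotangentBundle E Q))
    {A : Type*} [NormedAddCommGroup A] [NormedSpace ℝ A]
    {N : Type*} [TopologicalSpace N] [ChartedSpace A N] {f : N → S.constraintManifold} {x : N}
    (hf : ContMDiffAt 𝓘(ℝ, A) (cotangentModel E) ∞ (fun y => (f y : CotangentBundle E Q)) x) :
    ContMDiffAt 𝓘(ℝ, A) 𝓘(ℝ, EM) ∞ f x :=
  (ContMDiffAt.iff_comp_isImmersionAt (hM.isImmersion.isImmersionAt (f x))).2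
    ⟨hM.isEmbedding.isInducing.continuousAt_iff.2 hf.continuousAt, hf⟩

theorem mdifferentiableAt_val
    (hM : IsSmoothEmbedding 𝓘(ℝ, EM) (cotangentModel E) ∞
      (Subtype.val : S.constraintManifold → CotangentBundle E Q)) (m : S.constraintManifold) :
    MDifferentiableAt 𝓘(ℝ, EM) (cotangentModel E)
      (Subtype.val : S.constraintManifold → CotangentBundle E Q) m :=
  hM.contMDiff.mdifferentiable (by simp) m

variable {EG : Type*} [NormedAddCommGroup EG] [NormedSpace ℝ EG]
  {G : Type*} [TopologicalSpace G] [ChartedSpace EG G] [Group G] [MulAction G Q]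
  [ContMDiffSMul 𝓘(ℝ, EG) 𝓘(ℝ, E) ∞ G Q]

section Action

variable (hS : S.IsSymmetry G)

theorem actionM_one (m : S.constraintManifold) : actionM (EG := EG) hS 1 m = m :=
  Subtype.ext (cotangentLift_one _)

variable (EG) in
/-- The generator `ξ_{T^*Q}(p)` of the cotangent lifted action. -/
def generatorT (G : Type*) [TopologicalSpace G] [ChartedSpace EG G] [Group G] [MulAction G Q]
    (p : CotangentBundle E Q) : EG →L[ℝ] E × (E →L[ℝ] ℝ) :=
  infinitesimalGenerator (cotangentModel E)
    (cotangentLift : G → CotangentBundle E Q → CotangentBundle E Q) p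

variable [LieGroup 𝓘(ℝ, EG) ∞ G]

theorem hasMFDerivAt_cotangentLift (p : CotangentBundle E Q) :
    HasMFDerivAt 𝓘(ℝ, EG) (cotangentModel E) (fun g : G => cotangentLift g p) 1
      (generatorT EG G p : EG →L[ℝ] E × (E →L[ℝ] ℝ)) :=
  ((contMDiffAt_cotangentLift p).mdifferentiableAt (by simp)).hasMFDerivAt

theorem cotangentProjDeriv_generatorT (p : CotangentBundle E Q) (ξ : EG) :
    (cotangentProjDeriv p : E × (E →L[ℝ] ℝ) →L[ℝ] E) (generatorT EG G p ξ) =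
      generatorCLM (E := E) EG G p.proj ξ := by
  have h1 : ∀ p' : CotangentBundle E Q, p' = p → HasMFDerivAt (cotangentModel E) 𝓘(ℝ, E)
      (fun p : CotangentBundle E Q => p.proj) p'
      (cotangentProjDeriv p : E × (E →L[ℝ] ℝ) →L[ℝ] E) := by
    rintro _ rfl
    exact (contMDiff_cotangent_proj.mdifferentiable (by simp) _).hasMFDerivAt
  have h2 := (h1 _ (cotangentLift_one (G := G) p)).comp (1 : G)
    (hasMFDerivAt_cotangentLift (EG := EG) p)
  have h3 : HasMFDerivAt 𝓘(ℝ, EG) 𝓘(ℝ, E) (fun g : G => g • p.proj) 1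
      (generatorCLM EG G p.proj : EG →L[ℝ] E) :=
    ((contMDiff_orbit p.proj).mdifferentiable (by simp) 1).hasMFDerivAt
  exact congrArg (fun l : EG →L[ℝ] E => l ξ) (hasMFDerivAt_unique h2 h3)

variable [IsManifold 𝓘(ℝ, EM) ∞ S.constraintManifold]

theorem hasMFDerivAt_actionM
    (hM : IsSmoothEmbedding 𝓘(ℝ, EM) (cotangentModel E) ∞
      (Subtype.val : S.constraintManifold → CotangentBundle E Q))
    (m : S.constraintManifold) :
    HasMFDerivAt 𝓘(ℝ, EG) 𝓘(ℝ, EM) (fun g : G => actionM (EG := EG) hS g m) 1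
      (generatorM (EG := EG) EM hS m : EG →L[ℝ] EM) :=
  ((contMDiffAt_constraintManifold hM (contMDiffAt_cotangentLift m.1)).mdifferentiableAt
    (by simp)).hasMFDerivAt

theorem inclusionDeriv_generatorM
    (hM : IsSmoothEmbedding 𝓘(ℝ, EM) (cotangentModel E) ∞
      (Subtype.val : S.constraintManifold → CotangentBundle E Q))
    (m : S.constraintManifold) (ξ : EG) :
    (S.inclusionDeriv EM m : EM →L[ℝ] E × (E →L[ℝ] ℝ)) (generatorM (EG := EG) EM hS m ξ) =
      generatorT EG G m.1 ξ := by
  have h1 : ∀ m' : S.constraintManifold, m' = m → HasMFDerivAt 𝓘(ℝ, EM) (cotangentModel E)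
      (Subtype.val : S.constraintManifold → CotangentBundle E Q) m'
      (S.inclusionDeriv EM m : EM →L[ℝ] E × (E →L[ℝ] ℝ)) := by
    rintro _ rfl
    exact (mdifferentiableAt_val hM _).hasMFDerivAt
  have h2 := (h1 _ (actionM_one (EG := EG) hS m)).comp (1 : G) (hasMFDerivAt_actionM hS hM m)
  exact congrArg (fun l : EG →L[ℝ] E × (E →L[ℝ] ℝ) => l ξ)
    (hasMFDerivAt_unique h2 (hasMFDerivAt_cotangentLift m.1))

theorem mem_horizontalAlgebra_of_mem
    (hM : IsSmoothEmbedding 𝓘(ℝ, EM) (cotangentModel E) ∞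
      (Subtype.val : S.constraintManifold → CotangentBundle E Q))
    {m : S.constraintManifold}
    {ξ : GroupLieAlgebra 𝓘(ℝ, EG) G} (h : ξ ∈ S.constraintAlgebra (EG := EG) m.1.proj) :
    ξ ∈ horizontalAlgebra (EG := EG) EM hS m := by
  refine ⟨⟨ξ, rfl⟩, ?_⟩
  have h1 := (congrArg (cotangentProjDeriv m.1 : E × (E →L[ℝ] ℝ) →L[ℝ] E)
    (inclusionDeriv_generatorM (EG := EG) hS hM m ξ)).trans
    (cotangentProjDeriv_generatorT (EG := EG) (G := G) m.1 ξ)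
  exact (congrArg (fun w : E => w ∈ (S.constraint m.1.proj : Submodule ℝ E)) h1).mpr h

/-- An invariant function has vanishing derivative along the generators of the action. -/
theorem mvfderiv_generatorM
    (hM : IsSmoothEmbedding 𝓘(ℝ, EM) (cotangentModel E) ∞
      (Subtype.val : S.constraintManifold → CotangentBundle E Q))
    {h : S.constraintManifold → ℝ}
    (hh : ∀ (g : G) (m : S.constraintManifold), h (actionM (EG := EG) hS g m) = h m)
    (m : S.constraintManifold) (ξ : GroupLieAlgebra 𝓘(ℝ, EG) G) :
    mvfderiv 𝓘(ℝ, EM) h m (generatorM (EG := EG) EM hS m ξ) = 0 := by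
  by_cases hd : MDifferentiableAt 𝓘(ℝ, EM) 𝓘(ℝ, ℝ) h m
  · have h1 : ∀ m' : S.constraintManifold, m' = m → HasMFDerivAt 𝓘(ℝ, EM) 𝓘(ℝ, ℝ) h m'
        (mvfderiv 𝓘(ℝ, EM) h m : EM →L[ℝ] ℝ) := by
      rintro _ rfl
      exact hd.hasMFDerivAt
    have h2 := (h1 _ (actionM_one (EG := EG) hS m)).comp (1 : G) (hasMFDerivAt_actionM hS hM m)
    have h3 : h ∘ (fun g : G => actionM (EG := EG) hS g m) = fun _ => h m :=
      funext fun g => hh g m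
    rw [h3] at h2
    exact congrArg (fun l : EG →L[ℝ] ℝ => l ξ)
      (hasMFDerivAt_unique h2 (hasMFDerivAt_const (h m) (1 : G)))
  · -- where `h` is not differentiable, `mvfderiv` is zero by convention
    unfold mvfderiv
    rw [mfderiv_zero_of_not_mdifferentiableAt hd]
    simp

end Action

/-! ### The momentum equation -/

section MomentumEquation

variable [LieGroup 𝓘(ℝ, EG) ∞ G]

theorem contMDiffAt_momentumAlong
    (hM : IsSmoothEmbedding 𝓘(ℝ, EM) (cotangentModel E) ∞
      (Subtype.val : S.constraintManifold → CotangentBundle E Q))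
    {ξ : S.constraintManifold → GroupLieAlgebra 𝓘(ℝ, EG) G} {m : S.constraintManifold}
    (hξ : ContMDiffAt (M' := EG) 𝓘(ℝ, EM) 𝓘(ℝ, EG) ∞ ξ m) :
    ContMDiffAt 𝓘(ℝ, EM) 𝓘(ℝ, ℝ) ∞ (momentumAlong ξ) m :=
  ContMDiffAt.clm_apply (F₁ := EG)
    ((contMDiff_momentumCLM (EG := EG) (G := G)).contMDiffAt.comp m hM.contMDiff.contMDiffAt) hξ

/-- By the product rule and the Hamiltonian property of the momentum map, the momentum defect is
`ω_M(ξ(m)_M, X)`. -/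
theorem momentumDefect_eq
    (hM : IsSmoothEmbedding 𝓘(ℝ, EM) (cotangentModel E) ∞
      (Subtype.val : S.constraintManifold → CotangentBundle E Q))
    {ξ : S.constraintManifold → GroupLieAlgebra 𝓘(ℝ, EG) G} {m : S.constraintManifold}
    (hξ : MDifferentiableAt (M' := EG) 𝓘(ℝ, EM) 𝓘(ℝ, EG) ξ m)
    (X : ∀ m : S.constraintManifold, TangentSpace 𝓘(ℝ, EM) m) :
    momentumDefect EM X ξ m =
      canonicalForm m.1 (generatorT EG G m.1 (ξ m)) (S.inclusionDeriv EM m (X m)) := by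
  have hJ : MDifferentiableAt (cotangentModel E) 𝓘(ℝ, EG →L[ℝ] ℝ)
      (momentumCLM EG G : CotangentBundle E Q → EG →L[ℝ] ℝ) m.1 :=
    contMDiff_momentumCLM.mdifferentiable (by simp) _
  have hi := mdifferentiableAt_val hM m
  have hA := hJ.hasMFDerivAt.comp m hi.hasMFDerivAt
  have h1 := hasMFDerivAt_clm_apply (F := EG) hA hξ.hasMFDerivAt
  have hconst : HasFDerivAt (fun l : EG →L[ℝ] ℝ => l (ξ m : EG))
      (ContinuousLinearMap.apply (E := EG) ℝ ℝ (ξ m)) (momentumCLM EG G m.1) :=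
    (ContinuousLinearMap.apply (E := EG) ℝ ℝ (ξ m)).hasFDerivAt
  have h2 := HasMFDerivAt.comp m.1 hconst.hasMFDerivAt hJ.hasMFDerivAt
  have h3 := mfderiv_momentumCLM (EG := EG) (G := G) m.1 (ξ m) (S.inclusionDeriv EM m (X m))
  refine Eq.trans ?_ h3
  have h4 : mvfderiv 𝓘(ℝ, EM) (momentumAlong ξ) m (X m) = _ :=
    congrArg (fun l : EM →L[ℝ] ℝ => l (X m)) h1.mfderiv
  have h5 := congrArg (fun l : E × (E →L[ℝ] ℝ) →L[ℝ] ℝ => l (S.inclusionDeriv EM m (X m)))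
    h2.mfderiv
  unfold momentumDefect
  rw [h4]
  refine Eq.trans ?_ h5.symm
  exact add_sub_cancel_left _ _

variable [IsManifold 𝓘(ℝ, EM) ∞ S.constraintManifold]

/-- The momentum equation at a point. -/
theorem momentumDefect_eq_zero (hS : S.IsSymmetry G)
    (hM : IsSmoothEmbedding 𝓘(ℝ, EM) (cotangentModel E) ∞
      (Subtype.val : S.constraintManifold → CotangentBundle E Q))
    {ξ : S.constraintManifold → GroupLieAlgebra 𝓘(ℝ, EG) G} {m : S.constraintManifold}
    (hξ : MDifferentiableAt (M' := EG) 𝓘(ℝ, EM) 𝓘(ℝ, EG) ξ m)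
    (hξm : ξ m ∈ horizontalAlgebra (EG := EG) EM hS m)
    {h : S.constraintManifold → ℝ}
    (hh : ∀ (g : G) (m : S.constraintManifold), h (actionM (EG := EG) hS g m) = h m)
    {X : ∀ m : S.constraintManifold, TangentSpace 𝓘(ℝ, EM) m}
    (hX : (X m, mvfderiv 𝓘(ℝ, EM) h m) ∈ S.diracStructure EM m) :
    momentumDefect EM X ξ m = 0 := by
  rw [momentumDefect_eq hM hξ X]
  have h0 : generatorT EG G m.1 (ξ m) =
      S.inclusionDeriv EM m ((generatorM (EG := EG) EM hS m).toLinearMap (ξ m)) :=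
    (inclusionDeriv_generatorM (EG := EG) hS hM m (ξ m)).symm
  refine (congrArg (fun w => canonicalForm m.1 w (S.inclusionDeriv EM m (X m))) h0).trans ?_
  have h1 := hX.2 _ hξm.2
  have h2 := mvfderiv_generatorM hS hM hh m (ξ m)
  rw [canonicalForm_eq]
  simp only [formM] at h1
  rw [canonicalForm_eq] at h1
  have h3 : mvfderiv 𝓘(ℝ, EM) h m ((generatorM (EG := EG) EM hS m).toLinearMap (ξ m)) = 0 := h2
  rw [h3] at h1
  linarith!

end MomentumEquation

end System

/-! ### The Legendre transformation and the energy -/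

namespace System

section Energy

variable {E : Type*} [NormedAddCommGroup E] [NormedSpace ℝ E]
  {Q : Type*} [TopologicalSpace Q] [ChartedSpace E Q] [IsManifold 𝓘(ℝ, E) ∞ Q] {k : ℕ}
  (S : System E Q k)

/-- The metric at `q`, as a bilinear form on the model space. -/
def metricCLM (q : Q) : E →L[ℝ] E →L[ℝ] ℝ := S.metric.inner q

theorem metricCLM_comm (q : Q) (v w : E) : S.metricCLM q v w = S.metricCLM q w v :=
  S.metric.symm q v w

theorem eq_zero_of_metricCLM_self {q : Q} {v : E} (h : S.metricCLM q v v = 0) : v = 0 := by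
  by_contra hv
  exact (S.metric.pos q v hv).ne' h

theorem metricCLM_injective (q : Q) : Function.Injective (S.metricCLM q) := by
  rw [injective_iff_map_eq_zero]
  intro v hv
  exact S.eq_zero_of_metricCLM_self (by rw [hv]; rfl)

theorem covector_legendre (q : Q) (v : E) : covector (S.legendre ⟨q, v⟩) = S.metricCLM q v :=
  HasFDerivAt.fderiv (𝕜 := ℝ) (E := E) (F := ℝ) (S.hasFDerivAt_lagrangian q v)

/-- The Hamiltonian is the kinetic energy plus the potential energy. By injectivity of the metric
the inverse in its definition has its intended value. -/
theorem hamiltonian_legendre (q : Q) (v : E) :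
    S.hamiltonian (S.legendre ⟨q, v⟩) = 1 / 2 * S.metricCLM q v v + S.potential q := by
  have h1 : ∀ l : E →L[ℝ] ℝ, S.metricCLM q v = l →
      Function.invFun (fun w : E => covector (S.legendre ⟨q, w⟩)) l = v := by
    rintro _ rfl
    have : (fun w : E => covector (S.legendre ⟨q, w⟩)) = S.metricCLM q :=
      funext fun w => S.covector_legendre q w
    rw [this]
    exact Function.leftInverse_invFun (S.metricCLM_injective q) v
  have h2 := h1 _ (S.covector_legendre q v).symm
  have h3 : ∀ u : E, Function.invFun (fun w : E => covector (S.legendre ⟨q, w⟩))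
      (covector (S.legendre ⟨q, v⟩)) = u → S.hamiltonian (S.legendre ⟨q, v⟩) =
        covector (S.legendre ⟨q, v⟩) u -
          (1 / 2 * S.metricCLM q u u - S.potential q) := by
    rintro _ rfl
    rfl
  rw [h3 v h2, covector_legendre]
  ring

section Differentiability

/-- The metric in the preferred chart around `q₀`. -/
def metricCoord (q₀ q : Q) : E →L[ℝ] E →L[ℝ] ℝ :=
  ContinuousLinearMap.inCoordinates E (TangentSpace 𝓘(ℝ, E)) (E →L[ℝ] ℝ)
    (fun q : Q => TangentSpace 𝓘(ℝ, E) q →L[ℝ] ℝ) q₀ q q₀ q (S.metric.inner q)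

theorem contMDiffAt_metricCoord (q₀ : Q) :
    ContMDiffAt 𝓘(ℝ, E) 𝓘(ℝ, E →L[ℝ] E →L[ℝ] ℝ) ∞ (S.metricCoord q₀) q₀ :=
  ((contMDiffAt_hom_bundle _).1 (S.metric.contMDiff q₀)).2

theorem metricCoord_apply {q₀ q : Q} (hq : q ∈ (chartAt E q₀).source) (v w : E) :
    S.metricCoord q₀ q v w = S.metricCLM q (chartCoframe q₀ q v) (chartCoframe q₀ q w) := by
  have h := trivializationAt_symmL_eq hq
  have hq' : q ∈ (trivializationAt E (TangentSpace 𝓘(ℝ, E)) q₀).baseSet := hq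
  have h1 := inCoordinates_apply_eq₂ (F₁ := E) (E₁ := TangentSpace 𝓘(ℝ, E))
    (F₂ := E) (E₂ := TangentSpace 𝓘(ℝ, E)) (F₃ := ℝ) (E₃ := fun _ : Q => ℝ)
    (ϕ := S.metric.inner q) (v := v) (w := w) hq' hq' (Set.mem_univ q)
  rw [← h]
  simp at h1
  refine h1.trans ?_
  rw [← Bundle.Trivialization.symmL_apply (R := ℝ) _ hq',
    ← Bundle.Trivialization.symmL_apply (R := ℝ) _ hq']
  rfl

variable [FiniteDimensional ℝ E]

theorem exists_legendre_eq (p : CotangentBundle E Q) : ∃ v : E, S.legendre ⟨p.proj, v⟩ = p := by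
  have h1 : Function.Surjective (S.metricCLM p.proj).toLinearMap := by
    refine ((S.metricCLM p.proj).toLinearMap.injective_iff_surjective_of_finrank_eq_finrank
      ?_).1 (S.metricCLM_injective p.proj)
    rw [(LinearMap.toContinuousLinearMap (𝕜 := ℝ) (E := E) (F' := ℝ)).symm.finrank_eq]
    exact (Subspace.dual_finrank_eq).symm
  obtain ⟨v, hv⟩ := h1 (covector p)
  exact ⟨v, congrArg (fun l : E →L[ℝ] ℝ => (⟨p.proj, l⟩ : CotangentBundle E Q))
    ((S.covector_legendre p.proj v).trans hv)⟩

theorem exists_equiv_metricCoord {q₀ q : Q} (hq : q ∈ (chartAt E q₀).source) :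
    ∃ e : E ≃L[ℝ] (E →L[ℝ] ℝ), (e : E →L[ℝ] E →L[ℝ] ℝ) = S.metricCoord q₀ q := by
  have hinj : Function.Injective (S.metricCoord q₀ q).toLinearMap := by
    rw [injective_iff_map_eq_zero]
    intro v hv
    have h1 : S.metricCoord q₀ q v v = 0 := congrArg (fun l : E →L[ℝ] ℝ => l v) hv
    rw [metricCoord_apply S hq] at h1
    have h2 := chartFrame_chartCoframe hq v
    rw [S.eq_zero_of_metricCLM_self h1, map_zero] at h2
    exact h2.symm
  have hfin : Module.finrank ℝ E = Module.finrank ℝ (E →L[ℝ] ℝ) := by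
    rw [(LinearMap.toContinuousLinearMap (𝕜 := ℝ) (E := E) (F' := ℝ)).symm.finrank_eq]
    exact (Subspace.dual_finrank_eq).symm
  exact ⟨(LinearEquiv.ofInjectiveOfFinrankEq _ hinj hfin).toContinuousLinearEquiv, by ext; rfl⟩

/-- The energy in coordinates. -/
theorem hamiltonian_eq {q₀ : Q} {p : CotangentBundle E Q} (hp : p.proj ∈ (chartAt E q₀).source) :
    S.hamiltonian p = 1 / 2 * covectorCoord q₀ p
      ((S.metricCoord q₀ p.proj).inverse (covectorCoord q₀ p)) + S.potential p.proj := by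
  obtain ⟨v, hv⟩ := S.exists_legendre_eq p
  obtain ⟨e, he⟩ := S.exists_equiv_metricCoord hp
  have h1 : covectorCoord q₀ p = e (chartFrame q₀ p.proj v) := by
    ext w
    have h2 : e (chartFrame q₀ p.proj v) w = S.metricCoord q₀ p.proj (chartFrame q₀ p.proj v) w :=
      congrArg (fun l : E →L[ℝ] E →L[ℝ] ℝ => l (chartFrame q₀ p.proj v) w) he
    rw [h2, metricCoord_apply S hp, chartCoframe_chartFrame hp, covectorCoord_apply hp,
      ← covector_legendre, hv]
  have h3 : covector p = S.metricCLM p.proj v := by rw [← covector_legendre, hv]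
  rw [← he, ContinuousLinearMap.inverse_equiv]
  conv_rhs => rw [h1]
  rw [ContinuousLinearEquiv.coe_coe, e.symm_apply_apply, ← h1, covectorCoord_chartFrame hp, h3,
    ← hamiltonian_legendre, hv]

theorem mdifferentiableAt_hamiltonian (p : CotangentBundle E Q) :
    MDifferentiableAt (cotangentModel E) 𝓘(ℝ, ℝ) S.hamiltonian p := by
  have hp : p.proj ∈ (chartAt E p.proj).source := mem_chart_source E p.proj
  obtain ⟨e, he⟩ := S.exists_equiv_metricCoord hp
  have h1 : ContMDiffAt (cotangentModel E) 𝓘(ℝ, E →L[ℝ] E →L[ℝ] ℝ) ∞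
      (fun p' : CotangentBundle E Q => S.metricCoord p.proj p'.proj) p :=
    (S.contMDiffAt_metricCoord p.proj).comp p contMDiff_cotangent_proj.contMDiffAt
  have h2 : ContMDiffAt (cotangentModel E) 𝓘(ℝ, (E →L[ℝ] ℝ) →L[ℝ] E) ∞
      (fun p' : CotangentBundle E Q => (S.metricCoord p.proj p'.proj).inverse) p := by
    have := FiniteDimensional.complete ℝ E
    exact ContMDiffAt.comp_of_eq (contDiffAt_map_inverse e).contMDiffAt h1 he.symm
  have h3 := contMDiffAt_covectorCoord p
  have h4 := h3.clm_apply (h2.clm_apply h3)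
  have h5 : ContMDiffAt (cotangentModel E) 𝓘(ℝ, ℝ) ∞
      (fun p' : CotangentBundle E Q => S.potential p'.proj) p :=
    S.contMDiff_potential.contMDiffAt.comp p contMDiff_cotangent_proj.contMDiffAt
  have h6 := ((contMDiffAt_const (c := (1 / 2 : ℝ))).mul h4).add h5
  refine (h6.congr_of_eventuallyEq ?_).mdifferentiableAt (by simp)
  have h7 : ∀ᶠ p' : CotangentBundle E Q in 𝓝 p, p'.proj ∈ (chartAt E p.proj).source :=
    contMDiff_cotangent_proj.continuous.continuousAt
      ((chartAt E p.proj).open_source.mem_nhds hp)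
  filter_upwards [h7] with p' hp'
  exact S.hamiltonian_eq hp'

end Differentiability

section Invariance

variable {S} {G : Type*} [Group G] [MulAction G Q]

theorem IsSymmetry.potential_smul (hS : S.IsSymmetry G) (g : G) (q : Q) :
    S.potential (g • q) = S.potential q := by
  have h := hS.lagrangian_invariant g q (0 : E)
  have h1 : (1 / 2 * S.metricCLM (g • q) (tangentCLM E g q 0) (tangentCLM E g q 0) -
      S.potential (g • q) : ℝ) = 1 / 2 * S.metricCLM q 0 0 - S.potential q := h
  simpa using h1

theorem IsSymmetry.metricCLM_tangentCLM (hS : S.IsSymmetry G) (g : G) (q : Q) (v w : E) :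
    S.metricCLM (g • q) (tangentCLM E g q v) (tangentCLM E g q w) = S.metricCLM q v w := by
  have h1 : ∀ v : E, S.metricCLM (g • q) (tangentCLM E g q v) (tangentCLM E g q v) =
      S.metricCLM q v v := by
    intro v
    have h : (1 / 2 * S.metricCLM (g • q) (tangentCLM E g q v) (tangentCLM E g q v) -
      S.potential (g • q) : ℝ) = 1 / 2 * S.metricCLM q v v - S.potential q :=
      hS.lagrangian_invariant g q v
    rw [hS.potential_smul] at h
    linarith
  have h2 := h1 (v + w)
  simp only [map_add, add_apply, h1] at h2
  rw [S.metricCLM_comm (g • q) (tangentCLM E g q w), S.metricCLM_comm q w v] at h2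
  linarith

variable {EG : Type*} [NormedAddCommGroup EG] [NormedSpace ℝ EG]
  [TopologicalSpace G] [ChartedSpace EG G]

theorem cotangentLift_legendre (EG : Type*) [NormedAddCommGroup EG] [NormedSpace ℝ EG]
    [ChartedSpace EG G] [ContMDiffSMul 𝓘(ℝ, EG) 𝓘(ℝ, E) ∞ G Q] (hS : S.IsSymmetry G)
    (g : G) (q : Q) (v : E) :
    cotangentLift g (S.legendre ⟨q, v⟩) = S.legendre ⟨g • q, tangentCLM E g q v⟩ := by
  refine congrArg (fun l : E →L[ℝ] ℝ => (⟨g • q, l⟩ : CotangentBundle E Q)) ?_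
  refine Eq.trans ?_ (S.covector_legendre (g • q) (tangentCLM E g q v)).symm
  refine ContinuousLinearMap.ext fun w : E => ?_
  have h1 : tangentCLM E g q (tangentCLM E g⁻¹ (g • q) w) = w :=
    tangentAction_tangentAction_inv (EG := EG) g q w
  have h2 := hS.metricCLM_tangentCLM g q v (tangentCLM E g⁻¹ (g • q) w)
  rw [h1] at h2
  exact (congrArg (fun l : E →L[ℝ] ℝ => l (tangentCLM E g⁻¹ (g • q) w))
    (S.covector_legendre q v)).trans h2.symm

theorem hamiltonian_actionM [ContMDiffSMul 𝓘(ℝ, EG) 𝓘(ℝ, E) ∞ G Q] (hS : S.IsSymmetry G)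
    (g : G) (m : S.constraintManifold) :
    S.hamiltonian (actionM (EG := EG) hS g m) = S.hamiltonian m := by
  obtain ⟨_, ⟨q, v⟩, -, rfl⟩ := m
  refine (congrArg S.hamiltonian (cotangentLift_legendre EG hS g q v)).trans ?_
  refine (S.hamiltonian_legendre _ _).trans (Eq.trans ?_ (S.hamiltonian_legendre q v).symm)
  exact congrArg₂ (fun a b : ℝ => 1 / 2 * a + b) (hS.metricCLM_tangentCLM g q v v)
    (hS.potential_smul g q)

end Invariance

end Energy

end System

/-! ### Solutions are of second order -/

section ChartDeriv

variable {E : Type*} [NormedAddCommGroup E] [NormedSpace ℝ E]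
  {Q : Type*} [TopologicalSpace Q] [ChartedSpace E Q] [IsManifold 𝓘(ℝ, E) ∞ Q]

theorem chartDeriv_cotangent_fst (p : CotangentBundle E Q)
    (u : TangentSpace (cotangentModel E) p) :
    (chartDeriv (cotangentModel E) p u).1 = chartFrame (E := E) p.proj p.proj
      (cotangentProjDeriv p u) := by
  have h1 : HasMFDerivAt (cotangentModel E) 𝓘(ℝ, E × (E →L[ℝ] ℝ))
      (extChartAt (cotangentModel E) p) p (chartDeriv (cotangentModel E) p) :=
    (mdifferentiableAt_extChartAt (mem_chart_source _ p)).hasMFDerivAt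
  have hfst : HasMFDerivAt 𝓘(ℝ, E × (E →L[ℝ] ℝ)) 𝓘(ℝ, E) Prod.fst
      (extChartAt (cotangentModel E) p p) (ContinuousLinearMap.fst ℝ E (E →L[ℝ] ℝ)) :=
    hasFDerivAt_fst.hasMFDerivAt
  have h2 := HasMFDerivAt.comp p hfst h1
  have h3 : HasMFDerivAt 𝓘(ℝ, E) 𝓘(ℝ, E) (extChartAt 𝓘(ℝ, E) p.proj) p.proj
      (chartFrame (E := E) p.proj p.proj) :=
    (mdifferentiableAt_extChartAt (mem_chart_source E p.proj)).hasMFDerivAt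
  have h4 : HasMFDerivAt (cotangentModel E) 𝓘(ℝ, E)
      (fun p : CotangentBundle E Q => p.proj) p (cotangentProjDeriv p) :=
    (contMDiff_cotangent_proj.mdifferentiable (by simp) p).hasMFDerivAt
  have h5 := HasMFDerivAt.comp p h3 h4
  have h6 : Prod.fst ∘ extChartAt (cotangentModel E) p =
      extChartAt 𝓘(ℝ, E) p.proj ∘ fun p' : CotangentBundle E Q => p'.proj :=
    funext fun p' => congrArg Prod.fst (extChartAt_cotangent p p')
  rw [h6] at h2
  exact congrArg (fun l : E × (E →L[ℝ] ℝ) →L[ℝ] E => l u) (hasMFDerivAt_unique h2 h5)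

end ChartDeriv

namespace System

section SecondOrder

variable {E : Type*} [NormedAddCommGroup E] [NormedSpace ℝ E]
  {Q : Type*} [TopologicalSpace Q] [ChartedSpace E Q] [IsManifold 𝓘(ℝ, E) ∞ Q] {k : ℕ}
  (S : System E Q k)

/-- The line `t ↦ 𝔽L(v + t d)` in a fibre of `T^*Q`. -/
def legendreLine (q : Q) (v d : E) (t : ℝ) : CotangentBundle E Q :=
  S.legendre ⟨q, (v + t • d : E)⟩

theorem covectorCoord_legendreLine (q : Q) (v d : E) (t : ℝ) :
    covectorCoord q (S.legendreLine q v d t) =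
      (S.metricCLM q v).comp (chartCoframe q q) +
        t • (S.metricCLM q d).comp (chartCoframe q q) := by
  ext w
  have h1 : covectorCoord q (S.legendreLine q v d t) w =
      covector (S.legendreLine q v d t) (chartCoframe q q w) :=
    covectorCoord_apply (p := S.legendreLine q v d t) (mem_chart_source E q) w
  rw [h1, legendreLine, covector_legendre]
  simp

theorem legendreLine_zero (q : Q) (v d : E) : S.legendreLine q v d 0 = S.legendre ⟨q, v⟩ :=
  congrArg (fun y : E => S.legendre ⟨q, y⟩) (by simp : v + (0 : ℝ) • d = v)

theorem legendreLine_mem_constraintManifold {q : Q} {v d : E}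
    (hv : v ∈ (S.constraint q : Submodule ℝ E)) (hd : d ∈ (S.constraint q : Submodule ℝ E))
    (t : ℝ) : S.legendreLine q v d t ∈ S.constraintManifold :=
  ⟨⟨q, (v + t • d : E)⟩,
    (S.constraint q : Submodule ℝ E).add_mem hv (Submodule.smul_mem _ t hd), rfl⟩

theorem contMDiff_legendreLine (q : Q) (v d : E) :
    ContMDiff 𝓘(ℝ, ℝ) (cotangentModel E) ∞ (S.legendreLine q v d) := by
  intro t
  refine contMDiffAt_cotangent_iff.2 ⟨contMDiffAt_const (c := q), ?_⟩
  have h1 : (fun t' => covectorCoord (S.legendreLine q v d t).proj (S.legendreLine q v d t')) =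
      fun t' => (S.metricCLM q v).comp (chartCoframe q q) +
        t' • (S.metricCLM q d).comp (chartCoframe q q) :=
    funext fun t' => S.covectorCoord_legendreLine q v d t'
  rw [h1]
  exact ContDiffAt.contMDiffAt (by fun_prop)

/-- The velocity of a line in a fibre, in coordinates. -/
theorem chartDeriv_mfderiv_legendreLine (q : Q) (v d : E) :
    chartDeriv (cotangentModel E) (S.legendreLine q v d 0)
      (mfderiv 𝓘(ℝ, ℝ) (cotangentModel E) (S.legendreLine q v d) 0 (1 : ℝ)) =
      ((0 : E), (S.metricCLM q d).comp (chartCoframe q q)) := by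
  set p := S.legendreLine q v d 0 with hp
  have h1 : HasMFDerivAt (cotangentModel E) 𝓘(ℝ, E × (E →L[ℝ] ℝ))
      (extChartAt (cotangentModel E) p) p (chartDeriv (cotangentModel E) p) :=
    (mdifferentiableAt_extChartAt (mem_chart_source _ p)).hasMFDerivAt
  have h2 := HasMFDerivAt.comp (0 : ℝ) h1
    ((S.contMDiff_legendreLine q v d).mdifferentiable (by simp) 0).hasMFDerivAt
  have h3 : extChartAt (cotangentModel E) p ∘ S.legendreLine q v d =
      fun t : ℝ => (extChartAt 𝓘(ℝ, E) q q, (S.metricCLM q v).comp (chartCoframe q q) +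
        t • (S.metricCLM q d).comp (chartCoframe q q)) :=
    funext fun t => (extChartAt_cotangent p _).trans
      (congrArg (Prod.mk _) (S.covectorCoord_legendreLine q v d t))
  rw [h3] at h2
  have h4 : HasDerivAt (fun t : ℝ => (extChartAt 𝓘(ℝ, E) q q,
      (S.metricCLM q v).comp (chartCoframe q q) +
        t • (S.metricCLM q d).comp (chartCoframe q q)))
      ((0 : E), (S.metricCLM q d).comp (chartCoframe q q)) (0 : ℝ) := by
    refine (hasDerivAt_const _ _).prodMk ?_
    simpa using ((hasDerivAt_id (0 : ℝ)).smul_const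
      ((S.metricCLM q d).comp (chartCoframe q q))).const_add
        ((S.metricCLM q v).comp (chartCoframe q q))
  have h5 := congrArg (fun l : ℝ →L[ℝ] E × (E →L[ℝ] ℝ) => l 1)
    (hasMFDerivAt_unique h2 h4.hasFDerivAt.hasMFDerivAt)
  refine Eq.trans h5 ?_
  simp

theorem hasDerivAt_hamiltonian_legendreLine (q : Q) (v d : E) :
    HasDerivAt (fun t => S.hamiltonian (S.legendreLine q v d t)) (S.metricCLM q d v) 0 := by
  have h1 : (fun t => S.hamiltonian (S.legendreLine q v d t)) = fun t =>
      1 / 2 * (S.metricCLM q v v + t * (2 * S.metricCLM q d v) + t ^ 2 * S.metricCLM q d d) +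
        S.potential q := by
    funext t
    rw [legendreLine, hamiltonian_legendre]
    simp only [map_add, map_smul, add_apply, smul_apply, smul_eq_mul]
    rw [S.metricCLM_comm q v d]
    ring
  rw [h1]
  have h2 := ((((hasDerivAt_const (0 : ℝ) (S.metricCLM q v v)).add
    ((hasDerivAt_id (0 : ℝ)).mul_const (2 * S.metricCLM q d v))).add
    ((hasDerivAt_pow 2 (0 : ℝ)).mul_const (S.metricCLM q d d))).const_mul (1 / 2)).add_const
      (S.potential q)
  refine h2.congr_deriv ?_
  simp

variable {EM : Type*} [NormedAddCommGroup EM] [NormedSpace ℝ EM]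
  [ChartedSpace EM S.constraintManifold] [IsManifold 𝓘(ℝ, EM) ∞ S.constraintManifold]

/-- A vector `u` at `m = 𝔽L(v)` that pairs with the differential of the energy to an element of the
Dirac structure satisfies `Tπ u = v`. -/
theorem cotangentProjDeriv_eq_of_mem_diracStructure [FiniteDimensional ℝ E]
    (hM : IsSmoothEmbedding 𝓘(ℝ, EM) (cotangentModel E) ∞
      (Subtype.val : S.constraintManifold → CotangentBundle E Q))
    (m : S.constraintManifold) (u : TangentSpace 𝓘(ℝ, EM) m)
    (hu : (u, mvfderiv 𝓘(ℝ, EM) (fun m : S.constraintManifold => S.hamiltonian m) m) ∈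
      S.diracStructure EM m) {q : Q} {v : E} (hv : S.legendre ⟨q, v⟩ = m) :
    (cotangentProjDeriv m.1 (S.inclusionDeriv EM m u) : E) = v := by
  revert u
  obtain ⟨_, ⟨q', v'⟩, hv', rfl⟩ := m
  obtain rfl : q = q' := congrArg (fun p : CotangentBundle E Q => p.proj) hv
  have hvv : (v' : E) = v := S.metricCLM_injective q
    ((S.covector_legendre q v').symm.trans
      ((congrArg covector hv.symm).trans (S.covector_legendre q v)))
  obtain rfl : v = v' := hvv.symm
  set m : S.constraintManifold := ⟨S.legendre ⟨q, v⟩, ⟨q, v⟩, hv', rfl⟩ with hm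
  intro u hu
  set x : E := cotangentProjDeriv m.1 (S.inclusionDeriv EM m u) with hx
  have hxD : x ∈ (S.constraint q : Submodule ℝ E) := hu.1
  have hvD : v ∈ (S.constraint q : Submodule ℝ E) := hv'
  -- testing against the velocities of the lines in the fibre
  have key : ∀ d : E, d ∈ (S.constraint q : Submodule ℝ E) →
      S.metricCLM q d v = S.metricCLM q d x := by
    intro d hd
    have hmem := S.legendreLine_mem_constraintManifold (q := q) hvD hd
    have hsm : ContMDiffAt 𝓘(ℝ, ℝ) 𝓘(ℝ, EM) ∞
        (fun t => (⟨S.legendreLine q v d t, hmem t⟩ : S.constraintManifold)) 0 :=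
      contMDiffAt_constraintManifold hM (S.contMDiff_legendreLine q v d).contMDiffAt
    set f : ℝ → S.constraintManifold := fun t => ⟨S.legendreLine q v d t, hmem t⟩ with hf
    have h0 : S.legendreLine q v d 0 = S.legendre ⟨q, v⟩ := S.legendreLine_zero q v d
    have hf0 : f 0 = m := Subtype.ext h0
    have hfd := (hsm.mdifferentiableAt (by simp)).hasMFDerivAt
    set w : EM := (mfderiv 𝓘(ℝ, ℝ) 𝓘(ℝ, EM) f 0 : ℝ →L[ℝ] EM) 1 with hw
    -- the velocity in `T^*Q`
    have h1 : ∀ m' : S.constraintManifold, m' = m → HasMFDerivAt 𝓘(ℝ, EM) (cotangentModel E)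
        (Subtype.val : S.constraintManifold → CotangentBundle E Q) m'
        (S.inclusionDeriv EM m : EM →L[ℝ] E × (E →L[ℝ] ℝ)) := by
      rintro _ rfl
      exact (mdifferentiableAt_val hM _).hasMFDerivAt
    have h2 := HasMFDerivAt.comp (0 : ℝ) (h1 _ hf0) hfd
    have h3 : (S.inclusionDeriv EM m : EM →L[ℝ] E × (E →L[ℝ] ℝ)) w =
        (mfderiv 𝓘(ℝ, ℝ) (cotangentModel E) (S.legendreLine q v d) 0 :
          ℝ →L[ℝ] E × (E →L[ℝ] ℝ)) 1 :=
      congrArg (fun l : ℝ →L[ℝ] E × (E →L[ℝ] ℝ) => l 1) h2.mfderiv.symm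
    have h4 : (chartDeriv (cotangentModel E) m.1 : E × (E →L[ℝ] ℝ) →L[ℝ] E × (E →L[ℝ] ℝ))
        ((S.inclusionDeriv EM m : EM →L[ℝ] E × (E →L[ℝ] ℝ)) w) =
        ((0 : E), (S.metricCLM q d).comp (chartCoframe q q)) := by
      rw [h3, ← S.chartDeriv_mfderiv_legendreLine q v d]
      exact congrArg (fun p : CotangentBundle E Q =>
        (chartDeriv (cotangentModel E) p : E × (E →L[ℝ] ℝ) →L[ℝ] E × (E →L[ℝ] ℝ))
        ((mfderiv 𝓘(ℝ, ℝ) (cotangentModel E) (S.legendreLine q v d) 0 :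
          ℝ →L[ℝ] E × (E →L[ℝ] ℝ)) 1)) h0.symm
    -- it is horizontal
    have hframe : ∀ y : E, chartCoframe q q (chartFrame q q y) = y :=
      chartCoframe_chartFrame (mem_chart_source E q)
    have h5 : (cotangentProjDeriv m.1 : E × (E →L[ℝ] ℝ) →L[ℝ] E)
        ((S.inclusionDeriv EM m : EM →L[ℝ] E × (E →L[ℝ] ℝ)) w) = 0 := by
      have h6 : _ = chartFrame (E := E) q q _ :=
        chartDeriv_cotangent_fst m.1 (S.inclusionDeriv EM m w)
      rw [← hframe (cotangentProjDeriv m.1 (S.inclusionDeriv EM m w)), ← h6]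
      exact (congrArg (fun z : E × (E →L[ℝ] ℝ) => chartCoframe q q z.1) h4).trans (map_zero _)
    have hwH : w ∈ (S.horizontal EM m : Submodule ℝ EM) :=
      (congrArg (fun y : E => y ∈ (S.constraint q : Submodule ℝ E)) h5).mpr (Submodule.zero_mem _)
    have h7 := hu.2 w hwH
    -- the differential of the energy
    have hH : MDifferentiableAt 𝓘(ℝ, EM) 𝓘(ℝ, ℝ)
        (fun m : S.constraintManifold => S.hamiltonian m) m :=
      (S.mdifferentiableAt_hamiltonian m.1).comp m (mdifferentiableAt_val hM m)
    have h8 : ∀ m' : S.constraintManifold, m' = m → HasMFDerivAt 𝓘(ℝ, EM) 𝓘(ℝ, ℝ)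
        (fun m : S.constraintManifold => S.hamiltonian m) m'
        (mvfderiv 𝓘(ℝ, EM) (fun m : S.constraintManifold => S.hamiltonian m) m :
          EM →L[ℝ] ℝ) := by
      rintro _ rfl
      exact hH.hasMFDerivAt
    have h9 := HasMFDerivAt.comp (0 : ℝ) (h8 _ hf0) hfd
    have h10 : (mvfderiv 𝓘(ℝ, EM) (fun m : S.constraintManifold => S.hamiltonian m) m :
          EM →L[ℝ] ℝ) w = S.metricCLM q d v := by
      have h11 := congrArg (fun l : ℝ →L[ℝ] ℝ => l 1) (hasMFDerivAt_unique h9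
        (S.hasDerivAt_hamiltonian_legendreLine q v d).hasFDerivAt.hasMFDerivAt)
      refine Eq.trans h11 ?_
      simp
    have h12 : S.formM EM m u w = S.metricCLM q d x := by
      have h13 := canonicalForm_eq m.1 (S.inclusionDeriv EM m u) (S.inclusionDeriv EM m w)
      refine Eq.trans h13 ?_
      have h14 : _ = chartFrame (E := E) q q _ :=
        chartDeriv_cotangent_fst m.1 (S.inclusionDeriv EM m u)
      have h15 : chartDeriv (cotangentModel E) m.1 (S.inclusionDeriv EM m w) =
        ((0 : E), (S.metricCLM q d).comp (chartCoframe q q)) := h4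
      rw [h15, h14]
      simp only [map_zero, sub_zero, ContinuousLinearMap.comp_apply]
      exact congrArg (S.metricCLM q d) (hframe x)
    have h16 : S.metricCLM q d v - S.metricCLM q d x = 0 := by
      rw [← h10, ← h12]; exact h7
    linarith
  have h := key (v - x) (Submodule.sub_mem _ hvD hxD)
  have h' : S.metricCLM q (v - x) (v - x) = 0 := by
    rw [map_sub (S.metricCLM q (v - x)), h, sub_self]
  exact (sub_eq_zero.1 (S.eq_zero_of_metricCLM_self h')).symm

end SecondOrder

end System

/-! ### Derivatives along integral curves -/

theorem hasDerivAt_comp_integralCurve {A N F : Type*} [NormedAddCommGroup A] [NormedSpace ℝ A]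
    [TopologicalSpace N] [ChartedSpace A N] [NormedAddCommGroup F] [NormedSpace ℝ F]
    {X : ∀ x : N, TangentSpace 𝓘(ℝ, A) x} {γ : ℝ → N} {t₀ : ℝ}
    (hγ : IsMIntegralCurveAt γ X t₀) {f : N → F}
    (hf : MDifferentiableAt 𝓘(ℝ, A) 𝓘(ℝ, F) f (γ t₀)) :
    HasDerivAt (fun t => f (γ t)) (mvfderiv 𝓘(ℝ, A) f (γ t₀) (X (γ t₀))) t₀ := by
  have hf' : HasMFDerivAt 𝓘(ℝ, A) 𝓘(ℝ, F) f (γ t₀) (mvfderiv 𝓘(ℝ, A) f (γ t₀) : A →L[ℝ] F) :=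
    hf.hasMFDerivAt
  have h1 : HasFDerivAt (fun t => f (γ t)) ((mvfderiv 𝓘(ℝ, A) f (γ t₀) : A →L[ℝ] F).comp
      ((1 : ℝ →L[ℝ] ℝ).smulRight (X (γ t₀) : A))) t₀ :=
    hasMFDerivAt_iff_hasFDerivAt.1 (HasMFDerivAt.comp t₀ hf' hγ.hasMFDerivAt)
  refine HasDerivAt.congr_deriv h1.hasDerivAt ?_
  exact congrArg (mvfderiv 𝓘(ℝ, A) f (γ t₀) : A →L[ℝ] F) (one_smul ℝ (X (γ t₀) : A))

namespace System

variable {E : Type*} [NormedAddCommGroup E] [NormedSpace ℝ E]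
  {Q : Type*} [TopologicalSpace Q] [ChartedSpace E Q] [IsManifold 𝓘(ℝ, E) ∞ Q] {k : ℕ}
  {S : System E Q k}
  {EM : Type*} [NormedAddCommGroup EM] [NormedSpace ℝ EM]
  [ChartedSpace EM S.constraintManifold]

theorem hasMFDerivAt_proj_integralCurve
    (hM : IsSmoothEmbedding 𝓘(ℝ, EM) (cotangentModel E) ∞
      (Subtype.val : S.constraintManifold → CotangentBundle E Q))
    {X : ∀ m : S.constraintManifold, TangentSpace 𝓘(ℝ, EM) m} {γ : ℝ → S.constraintManifold}
    {t₀ : ℝ} (hγ : IsMIntegralCurveAt γ X t₀) :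
    HasMFDerivAt 𝓘(ℝ, ℝ) 𝓘(ℝ, E) (fun t => (γ t).1.proj) t₀
      ((1 : ℝ →L[ℝ] ℝ).smulRight
        (cotangentProjDeriv (γ t₀).1 (S.inclusionDeriv EM (γ t₀) (X (γ t₀))) : E)) := by
  have h1 : HasMFDerivAt (cotangentModel E) 𝓘(ℝ, E)
      (fun p : CotangentBundle E Q => p.proj) (γ t₀).1 (cotangentProjDeriv (γ t₀).1) :=
    (contMDiff_cotangent_proj.mdifferentiable (by simp) _).hasMFDerivAt
  have h2 := HasMFDerivAt.comp t₀ h1 (HasMFDerivAt.comp t₀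
    (mdifferentiableAt_val hM (γ t₀)).hasMFDerivAt hγ.hasMFDerivAt)
  refine HasMFDerivAt.congr_mfderiv h2 ?_
  exact ContinuousLinearMap.ext fun s : ℝ => map_smul
    (((cotangentProjDeriv (γ t₀).1 : E × (E →L[ℝ] ℝ) →L[ℝ] E).comp
      (S.inclusionDeriv EM (γ t₀) : EM →L[ℝ] E × (E →L[ℝ] ℝ)))) s (X (γ t₀) : EM)

variable [IsManifold 𝓘(ℝ, EM) ∞ S.constraintManifold]
  {EG : Type*} [NormedAddCommGroup EG] [NormedSpace ℝ EG]
  {G : Type*} [TopologicalSpace G] [ChartedSpace EG G] [Group G] [MulAction G Q]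
  [ContMDiffSMul 𝓘(ℝ, EG) 𝓘(ℝ, E) ∞ G Q] [LieGroup 𝓘(ℝ, EG) ∞ G]

/-- A section of `𝔤^𝒟` pulls back to a section of `𝔤^ℋ`. -/
theorem isSectionOn_comp_proj (hS : S.IsSymmetry G)
    (hM : IsSmoothEmbedding 𝓘(ℝ, EM) (cotangentModel E) ∞
      (Subtype.val : S.constraintManifold → CotangentBundle E Q))
    {W : Set Q} {ξ : Q → GroupLieAlgebra 𝓘(ℝ, EG) G}
    (hξ : ContMDiffOn (M' := EG) 𝓘(ℝ, E) 𝓘(ℝ, EG) ∞ ξ W)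
    (hξW : ∀ q ∈ W, ξ q ∈ S.constraintAlgebra q) :
    IsSectionOn EM hS (fun m => ξ m.1.proj) {m | m.1.proj ∈ W} where
  contMDiffOn :=
    ContMDiffOn.comp (t := W) hξ (contMDiff_cotangent_proj.comp hM.contMDiff).contMDiffOn
      fun _ hm => hm
  mem_algebra _ hm := mem_horizontalAlgebra_of_mem hS hM (hξW _ hm)

end System
end Nonholonomic
end

theorem theorem6p1
    -- the configuration manifold with metric, potential and constraints
    {E : Type*} [NormedAddCommGroup E] [NormedSpace ℝ E] [FiniteDimensional ℝ E]
    {Q : Type*} [TopologicalSpace Q] [ChartedSpace E Q] [IsManifold 𝓘(ℝ, E) ∞ Q]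
    {k : ℕ} (S : System E Q k)
    -- the symmetry Lie group
    {EG : Type*} [NormedAddCommGroup EG] [NormedSpace ℝ EG] [FiniteDimensional ℝ EG]
    {G : Type*} [TopologicalSpace G] [ChartedSpace EG G] [Group G] [LieGroup 𝓘(ℝ, EG) ∞ G]
    [MulAction G Q] [ContMDiffSMul 𝓘(ℝ, EG) 𝓘(ℝ, E) ∞ G Q] (hS : S.IsSymmetry G)
    -- the constraint manifold with its structure of embedded submanifold of the cotangent bundle
    {EM : Type*} [NormedAddCommGroup EM] [NormedSpace ℝ EM] [FiniteDimensional ℝ EM]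
    [ChartedSpace EM S.constraintManifold] [IsManifold 𝓘(ℝ, EM) ∞ S.constraintManifold]
    (_hM : IsSmoothEmbedding 𝓘(ℝ, EM) (cotangentModel E) ∞
      (Subtype.val : S.constraintManifold → CotangentBundle E Q))
    -- the distribution `ℋ + 𝒱` has constant rank
    (_hrank : ∃ r : ℕ, ∀ m : S.constraintManifold,
      Module.finrank ℝ ↥(S.horizontal EM m ⊔ System.vertical (EG := EG) EM hS m) = r) :
    -- the nonholonomic momentum equation
    (∀ (U : Set S.constraintManifold), IsOpen U →
      ∀ ξ : S.constraintManifold → GroupLieAlgebra 𝓘(ℝ, EG) G,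
      System.IsSectionOn EM hS ξ U →
      ∀ h : S.constraintManifold → ℝ, ContMDiff 𝓘(ℝ, EM) 𝓘(ℝ, ℝ) ∞ h →
      (∀ (g : G) (m : S.constraintManifold), h (System.actionM (EG := EG) hS g m) = h m) →
      ∀ X : ∀ m : S.constraintManifold, TangentSpace 𝓘(ℝ, EM) m,
      S.IsSolutionOn EM h X U →
      ContMDiffOn 𝓘(ℝ, EM) 𝓘(ℝ, ℝ) ∞ (System.momentumAlong ξ) U ∧
      ∀ m ∈ U, System.momentumDefect EM X ξ m = 0) ∧
    -- the Lagrangian form of the equation, for a section of `𝔤^𝒟`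
    (∀ (W : Set Q), IsOpen W →
      ∀ ξ : Q → GroupLieAlgebra 𝓘(ℝ, EG) G,
      ContMDiffOn (M' := EG) 𝓘(ℝ, E) 𝓘(ℝ, EG) ∞ ξ W →
      (∀ q ∈ W, ξ q ∈ S.constraintAlgebra q) →
      System.IsSectionOn EM hS (fun m => ξ m.1.proj) {m | m.1.proj ∈ W} ∧
      ∀ (X : ∀ m : S.constraintManifold, TangentSpace 𝓘(ℝ, EM) m)
        (γ : ℝ → S.constraintManifold) (c : ℝ → TangentBundle 𝓘(ℝ, E) Q) (t₀ : ℝ),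
        IsMIntegralCurveAt γ X t₀ →
        (∀ᶠ t in 𝓝 t₀, S.legendre (c t) = γ t) →
        (c t₀).proj ∈ W →
        (DifferentiableAt ℝ (fun t => S.lagrangianMomentum (c t) (ξ (c t).proj)) t₀ ∧
          DifferentiableAt (F := EG) ℝ (fun t => ξ (c t).proj) t₀ ∧
          System.momentumDefect EM X (fun m => ξ m.1.proj) (γ t₀) =
            deriv (fun t => S.lagrangianMomentum (c t) (ξ (c t).proj)) t₀ -
              S.lagrangianMomentum (G := G) (c t₀) (deriv (F := EG) (fun t => ξ (c t).proj) t₀)) ∧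
        ∀ U : Set S.constraintManifold, IsOpen U → γ t₀ ∈ U →
          S.IsSolutionOn EM (fun m => S.hamiltonian m) X U →
          HasMFDerivAt 𝓘(ℝ, ℝ) 𝓘(ℝ, E) (fun t => (c t).proj) t₀
            ((1 : ℝ →L[ℝ] ℝ).smulRight (c t₀).snd) ∧
          HasDerivAt (fun t => S.lagrangianMomentum (c t) (ξ (c t).proj))
            (S.lagrangianMomentum (G := G) (c t₀) (deriv (F := EG) (fun t => ξ (c t).proj) t₀)) t₀) := by
  refine ⟨fun U hU ξ hξ h _ hh X hX => ⟨fun m hm => ?_, fun m hm => ?_⟩,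
    fun W hW ξ hξ hξW => ?_⟩
  · exact (System.contMDiffAt_momentumAlong _hM
      (hξ.contMDiffOn.contMDiffAt (hU.mem_nhds hm))).contMDiffWithinAt
  · exact System.momentumDefect_eq_zero hS _hM
      ((hξ.contMDiffOn.contMDiffAt (hU.mem_nhds hm)).mdifferentiableAt (by simp))
      (hξ.mem_algebra m hm) hh (hX.mem_dirac m hm)
  have hsec := System.isSectionOn_comp_proj hS _hM hξ hξW
  refine ⟨hsec, fun X γ c t₀ hγ hc hcW => ?_⟩
  have hproj : ∀ᶠ t in 𝓝 t₀, (c t).proj = (γ t).1.proj :=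
    hc.mono fun t ht => congrArg (fun p : CotangentBundle E Q => p.proj) ht
  have hc₀ : S.legendre (c t₀) = γ t₀ := hc.self_of_nhds
  have hγW : (γ t₀).1.proj ∈ W := hproj.self_of_nhds ▸ hcW
  have hopen : IsOpen {m : S.constraintManifold | m.1.proj ∈ W} :=
    hW.preimage (contMDiff_cotangent_proj.comp _hM.contMDiff).continuous
  have hη := hsec.contMDiffOn.contMDiffAt (hopen.mem_nhds hγW)
  have hmom : ∀ (p p' : CotangentBundle E Q) (η : GroupLieAlgebra 𝓘(ℝ, EG) G), p = p' →
      momentumMap p η = momentumMap p' η := by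
    rintro _ _ _ rfl; rfl
  -- both functions of time are restrictions to the curve of functions on `M`
  have hξc : HasDerivAt (F := EG) (fun t => ξ (c t).proj)
      (System.derivAlong EM X (fun m => ξ m.1.proj) (γ t₀)) t₀ :=
    HasDerivAt.congr_of_eventuallyEq
      (hasDerivAt_comp_integralCurve (F := EG) hγ (hη.mdifferentiableAt (by simp)))
      (hproj.mono fun t ht => congrArg (fun q => (ξ q : EG)) ht)
  have hJc : HasDerivAt (fun t => S.lagrangianMomentum (c t) (ξ (c t).proj))
      (mvfderiv 𝓘(ℝ, EM) (System.momentumAlong (fun m => ξ m.1.proj)) (γ t₀) (X (γ t₀))) t₀ :=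
    HasDerivAt.congr_of_eventuallyEq
      (hasDerivAt_comp_integralCurve hγ
        ((System.contMDiffAt_momentumAlong _hM hη).mdifferentiableAt (by simp)))
      (hc.mono fun t ht => congrArg (fun p : CotangentBundle E Q => momentumMap p (ξ p.proj)) ht)
  have hdef : System.momentumDefect EM X (fun m => ξ m.1.proj) (γ t₀) =
      deriv (fun t => S.lagrangianMomentum (c t) (ξ (c t).proj)) t₀ -
        S.lagrangianMomentum (G := G) (c t₀) (deriv (F := EG) (fun t => ξ (c t).proj) t₀) := by
    rw [hJc.deriv]
    refine congrArg (fun r : ℝ => _ - r) ?_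
    refine (hmom _ _ _ hc₀.symm).trans ?_
    exact congrArg (fun η : EG => S.lagrangianMomentum (EG := EG) (G := G) (c t₀) η)
      (HasDerivAt.deriv (F := EG) hξc).symm
  refine ⟨⟨hJc.differentiableAt, HasDerivAt.differentiableAt (F := EG) hξc, hdef⟩,
    fun U _ hγU hX => ⟨?_, ?_⟩⟩
  · have h1 := System.hasMFDerivAt_proj_integralCurve _hM hγ
    have h2 : (cotangentProjDeriv (γ t₀).1 (S.inclusionDeriv EM (γ t₀) (X (γ t₀))) : E) =
        (c t₀).snd :=
      S.cotangentProjDeriv_eq_of_mem_diracStructure _hM (γ t₀) (X (γ t₀))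
        (hX.mem_dirac _ hγU) hc₀
    rw [h2] at h1
    exact h1.congr_of_eventuallyEq hproj
  · have h0 := System.momentumDefect_eq_zero hS _hM (hη.mdifferentiableAt (by simp))
      (hsec.mem_algebra _ hγW) (System.hamiltonian_actionM (EG := EG) hS)
      (hX.mem_dirac _ hγU)
    rw [hdef, sub_eq_zero] at h0
    exact h0 ▸ hJc.differentiableAt.hasDerivAt
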